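/- Conventions. Let $(\Omega,\mathcal A,\mathbb P)$ be a probability space and $d\in\mathbb N$. A *real measure* over a Borel set $D$ is a real-valued function that is $\sigma$-additive on the bounded Borel subsets of $D$; its total variation is $|\mu|(A)=\sup\sum_j|\mu(I_j)|$ over finite Borel partitions $(I_j)$ of $A$. A *random measure* over $D\subseteq\mathbb R^d$ is a function $N$ from the bounded Borel subsets of $D$ to $L^2(\Omega,\mathcal A,\mathbb P)$ that is $\sigma$-additive and for which there is a real measure $C_N$ over $D\times D$ (the covariance measure) with $C_N(A\times B)=\mathrm{Cov}(N(A),N(B))$; its mean measure is $A\mapsto\mathbb E(N(A))$. A *Riemann system* of a bounded Borel set $A$ is a sequence, indexed by $n$, of finite Borel partitions $(I^n_j)_{j\in J_n}$ of $A$ with tags $x^n_j\in I^n_j$ and $\max_j\mathrm{diam}(I^n_j)\to0$. A kernel $K:\mathbb R^d\times\mathcal B_B(\mathbb R^d)\to\mathbb R$ ($\mathcal B_B$ denoting the bounded Borel sets) is *self-integrable* over $A$ if there is a unique $\ell\in\mathbb R$ with $\lim_n\sum_{j}K(x^n_j,I^n_j)=\ell$ for every Riemann system of $A$; then $\int_AK(x,dx):=\ell$.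 If each $K(x,\cdot)$ is a real measure, put $K^{(2)}((x,y),E)=(K(y,\cdot)\otimes K(x,\cdot))(E)$ for bounded Borel $E\subset\mathbb R^d\times\mathbb R^d$. A kernel $H:(\mathbb R^d\times\mathbb R^d)\times\mathcal B_B(\mathbb R^d\times\mathbb R^d)\to\mathbb R$ is *quasi-self-integrable* over $A\times B$ if there is $\ell\in\mathbb R$ such that $\lim_{(n,m)\to\infty}\sum_j\sum_kH((a^n_j,b^m_k),A^n_j\times B^m_k)=\ell$ for all Riemann systems $(A^n_j,a^n_j)$ of $A$ and $(B^m_k,b^m_k)$ of $B$; then $\widetilde\int_{A\times B}H(x,dx):=\ell$. Write $|K|(x,A)=|K(x,\cdot)|(A)$, and likewise for $|K^{(2)}|$. Statement. Let $Z$ be a centred, second-order, mean-square continuous real process over $\mathbb R^d$ and $M$ a centred random measure over $\mathbb R^d$ with covariance measure $C_M$, such that $Z$ and $M$ are jointly Gaussian (all vectors $(Z(x_1),\dots,Z(x_n),M(A_1),\dots,M(A_m))$ are Gaussian, the $A_i$ being bounded Borel sets). Put $C_Z(x,y)=\mathrm{Cov}(Z(x),Z(y))$ and $K_{Z,M}(x,A)=\mathrm{Cov}(Z(x),M(A))$.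 Let $D\subset\mathbb R^d$ be compact. Suppose that $K_{Z,M}$ and $|K_{Z,M}|$ are self-integrable over $D$ and that $K_{Z,M}^{(2)}$ and $|K_{Z,M}^{(2)}|$ are quasi-self-integrable over $D\times D$. Then for every Borel $A\subseteq D$ the stochastic integral $\int_AZ\,dM$ is uniquely defined, that is, the Riemann sums $\sum_jZ(x^n_j)M(I^n_j)$ converge in $L^2(\Omega,\mathcal A,\mathbb P)$ to one and the same random variable $\int_AZ\,dM$ for all Riemann systems of $A$; the function $A\mapsto\int_AZ\,dM$ is a random measure over $D$; and for all Borel $A,B\subseteq D$, $K_{Z,M}$ is self-integrable over $A$, $K_{Z,M}^{(2)}$ is quasi-self-integrable over $A\times B$, and $$\mathbb E\Big(\int_AZ\,dM\Big)=\int_AK_{Z,M}(x,dx),\qquad \mathrm{Cov}\Big(\int_AZ\,dM,\int_BZ\,dM\Big)=\int_{A\times B}C_Z\,dC_M+\widetilde\int_{A\times B}K_{Z,M}^{(2)}(x,dx).$$ -/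

import Mathlib

open MeasureTheory ProbabilityTheory Filter Set Bornology
open scoped Topology ENNReal Function

noncomputable section

namespace SelfIntegral

/-! ### Real measures on the bounded Borel sets -/

/-- A real measure over `D`: a real function, σ-additive on the bounded measurable subsets of `D`
(its values on other sets are irrelevant). -/
structure RealMeasureOn {X : Type*} [MeasurableSpace X] [Bornology X] (D : Set X) where
  toFun : Set X → ℝ
  hasSum_iUnion' : ∀ A : ℕ → Set X, (∀ i, MeasurableSet (A i)) → Pairwise (Disjoint on A) →
    IsBounded (⋃ i, A i) → (⋃ i, A i) ⊆ D → HasSum (fun i => toFun (A i)) (toFun (⋃ i, A i))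

namespace RealMeasureOn

variable {X Y : Type*} [MeasurableSpace X] [Bornology X] [MeasurableSpace Y] [Bornology Y]

instance (D : Set X) : CoeFun (RealMeasureOn D) (fun _ => Set X → ℝ) := ⟨toFun⟩

theorem apply_empty {D : Set X} (μ : RealMeasureOn D) : μ ∅ = 0 := by
  have h := μ.hasSum_iUnion' (fun _ => ∅) (fun _ => MeasurableSet.empty)
    (fun i j _ => disjoint_bot_left) (by simp) (by simp)
  have h2 := h.summable.tendsto_atTop_zero
  simpa using tendsto_nhds_unique tendsto_const_nhds h2

open Classical in
/-- The finite signed measure `S ↦ μ (S ∩ A)`, for a bounded measurable `A ⊆ D`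
(and `0` for other `A`). -/
def window {D : Set X} (μ : RealMeasureOn D) (A : Set X) : SignedMeasure X :=
  if h : MeasurableSet A ∧ IsBounded A ∧ A ⊆ D then
    { measureOf' := fun S => if MeasurableSet S then μ (S ∩ A) else 0
      empty' := by simp [μ.apply_empty]
      not_measurable' := fun S hS => by simp [hS]
      m_iUnion' := fun f hf hd => by
        have := μ.hasSum_iUnion' (fun i => f i ∩ A) (fun i => (hf i).inter h.1)
          (fun i j hij => (hd hij).mono inter_subset_left inter_subset_left)
          (h.2.1.subset (iUnion_subset fun i => inter_subset_right))
          ((iUnion_subset fun i => inter_subset_right).trans h.2.2)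
        simpa [hf, MeasurableSet.iUnion hf, iUnion_inter] using this }
  else 0

/-- The integral `∫_A f dμ` over a bounded measurable set `A ⊆ D`. -/
def integralOver {D : Set X} (μ : RealMeasureOn D) (A : Set X) (f : X → ℝ) : ℝ :=
  ∫ᵛ x, f x ∂•(μ.window A)

/-- The product `μ ⊗ ν` of two real measures, evaluated at a bounded measurable set `S`: the two
factors are first restricted to bounded closed sets whose product contains `S`. -/
def prod [TopologicalSpace X] [TopologicalSpace Y] (μ : RealMeasureOn (univ : Set X))
    (ν : RealMeasureOn (univ : Set Y)) (S : Set (X × Y)) : ℝ :=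
  (μ.window (closure (Prod.fst '' S))).prod (ν.window (closure (Prod.snd '' S)))
    (ContinuousLinearMap.mul ℝ ℝ) S

end RealMeasureOn

/-- The total variation of a set function on `A`: the supremum of `∑ j, |μ (I j)|` over the finite
measurable partitions `I` of `A`. -/
def totalVariation {X : Type*} [MeasurableSpace X] (μ : Set X → ℝ) (A : Set X) : ℝ :=
  sSup {s : ℝ | ∃ (n : ℕ) (I : Fin n → Set X), (∀ j, MeasurableSet (I j)) ∧
    Pairwise (Disjoint on I) ∧ (⋃ j, I j) = A ∧ s = ∑ j, |μ (I j)|}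

/-- The total-variation kernel `|K|(x, A) = |K(x, ·)|(A)`. -/
def tvKernel {X Y : Type*} [MeasurableSpace Y] (K : X → Set Y → ℝ) : X → Set Y → ℝ :=
  fun x A => totalVariation (K x) A

/-- The second-order kernel `K⁽²⁾((x, y), S) = (K(y, ·) ⊗ K(x, ·))(S)`. -/
def secondOrderKernel {X Y : Type*} [MeasurableSpace Y] [Bornology Y] [TopologicalSpace Y]
    (K : X → RealMeasureOn (univ : Set Y)) : X × X → Set (Y × Y) → ℝ :=
  fun p S => (K p.2).prod (K p.1) S

/-! ### Riemann systems and self-integrals -/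

/-- A Riemann system of `D`: a sequence of finite measurable partitions of `D` with mesh tending
to `0`, and a tag in every cell. (If `D` is infinite, the number of cells necessarily tends
to infinity; if `D` is finite, the cells are eventually singletons.) -/
structure RiemannSystem {X : Type*} [MeasurableSpace X] [PseudoEMetricSpace X] (D : Set X) where
  card : ℕ → ℕ
  cell : (n : ℕ) → Fin (card n) → Set X
  tag : (n : ℕ) → Fin (card n) → X
  measurableSet_cell : ∀ n j, MeasurableSet (cell n j)
  disjoint_cell : ∀ n, Pairwise (Disjoint on cell n)
  iUnion_cell : ∀ n, (⋃ j, cell n j) = D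
  tag_mem : ∀ n j, tag n j ∈ cell n j
  tendsto_mesh : Tendsto (fun n => ⨆ j, Metric.ediam (cell n j)) atTop (𝓝 0)

section Integrals

variable {X : Type*} [MeasurableSpace X] [PseudoEMetricSpace X]

/-- `ℓ` is the limit of the Riemann sums of `K` along every Riemann system of `D`. -/
def IsSelfIntegral (K : X → Set X → ℝ) (D : Set X) (l : ℝ) : Prop :=
  ∀ R : RiemannSystem D,
    Tendsto (fun n => ∑ j, K (R.tag n j) (R.cell n j)) atTop (𝓝 l)

/-- `K` is self-integrable over `D`. -/
def SelfIntegrable (K : X → Set X → ℝ) (D : Set X) : Prop :=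
  ∃! l : ℝ, IsSelfIntegral K D l

/-- `ℓ` is the double limit of the Riemann sums of the kernel `H` along every pair of Riemann
systems of `A` and of `B`. -/
def IsQuasiSelfIntegral (H : X × X → Set (X × X) → ℝ) (A B : Set X) (l : ℝ) : Prop :=
  ∀ (R : RiemannSystem A) (S : RiemannSystem B),
    Tendsto (fun q : ℕ × ℕ => ∑ j, ∑ k,
      H (R.tag q.1 j, S.tag q.2 k) (R.cell q.1 j ×ˢ S.cell q.2 k)) (atTop ×ˢ atTop) (𝓝 l)

/-- `H` is quasi-self-integrable over `A × B`. -/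
def QuasiSelfIntegrable (H : X × X → Set (X × X) → ℝ) (A B : Set X) : Prop :=
  ∃ l : ℝ, IsQuasiSelfIntegral H A B l

end Integrals

/-! ### Mean-square continuous processes and random measures -/

/-- A second-order, mean-square continuous real process indexed by `X`. -/
structure MSProcess {Ω : Type*} [MeasurableSpace Ω] (P : Measure Ω) (X : Type*)
    [TopologicalSpace X] where
  toFun : X → Ω → ℝ
  memLp : ∀ x, MemLp (toFun x) 2 P
  tendsto_L2 : ∀ x₀, Tendsto (fun x => eLpNorm (toFun x - toFun x₀) 2 P) (𝓝 x₀) (𝓝 0)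

/-- A random measure over `D`: an `L²`-valued function, σ-additive on the bounded measurable
subsets of `D`, whose covariance structure is a real measure `cov` over `D × D`. -/
structure RandomMeasure {Ω : Type*} [MeasurableSpace Ω] (P : Measure Ω) {X : Type*}
    [MeasurableSpace X] [Bornology X] (D : Set X) where
  toFun : Set X → Lp ℝ 2 P
  hasSum_iUnion' : ∀ A : ℕ → Set X, (∀ i, MeasurableSet (A i)) → Pairwise (Disjoint on A) →
    IsBounded (⋃ i, A i) → (⋃ i, A i) ⊆ D → HasSum (fun i => toFun (A i)) (toFun (⋃ i, A i))
  cov : RealMeasureOn (D ×ˢ D)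
  cov_prod : ∀ A B : Set X, MeasurableSet A → IsBounded A → A ⊆ D →
    MeasurableSet B → IsBounded B → B ⊆ D → cov (A ×ˢ B) = cov[toFun A, toFun B; P]

section Stochastic

variable {Ω : Type*} [MeasurableSpace Ω] {P : Measure Ω}

instance {X : Type*} [TopologicalSpace X] : CoeFun (MSProcess P X) (fun _ => X → Ω → ℝ) :=
  ⟨MSProcess.toFun⟩

instance {X : Type*} [MeasurableSpace X] [Bornology X] (D : Set X) :
    CoeFun (RandomMeasure P D) (fun _ => Set X → Lp ℝ 2 P) :=
  ⟨RandomMeasure.toFun⟩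

theorem integral_L2_eq_inner [IsProbabilityMeasure P] (f : Lp ℝ 2 P) :
    ∫ ω, f ω ∂P = inner ℝ ((memLp_const (1 : ℝ)).toLp (fun _ : Ω => (1 : ℝ)) : Lp ℝ 2 P) f := by
  rw [L2.inner_def]
  refine integral_congr_ae ?_
  filter_upwards with ω
  simp

theorem covariance_L2_eq_inner [IsProbabilityMeasure P] {g : Ω → ℝ} (hg : MemLp g 2 P)
    (f : Lp ℝ 2 P) :
    cov[g, f; P] = inner ℝ (hg.toLp g) f - (∫ ω, g ω ∂P) * ∫ ω, f ω ∂P := by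
  rw [covariance_eq_sub hg (Lp.memLp f), L2.inner_def]
  congr 1
  refine integral_congr_ae ?_
  filter_upwards [hg.coeFn_toLp] with ω h
  simp [h, mul_comm]

/-- The mean measure `A ↦ E[M(A)]`. -/
def RandomMeasure.mean [IsProbabilityMeasure P] {X : Type*} [MeasurableSpace X] [Bornology X]
    {D : Set X} (M : RandomMeasure P D) : RealMeasureOn D where
  toFun A := ∫ ω, M A ω ∂P
  hasSum_iUnion' A hA hd hb hD := by
    simp only [integral_L2_eq_inner]
    exact (M.hasSum_iUnion' A hA hd hb hD).mapL (innerSL ℝ _)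

/-- The cross-covariance kernel `K_{Z,M}(x, A) = Cov(Z(x), M(A))`. -/
def crossCov [IsProbabilityMeasure P] {X Y : Type*} [TopologicalSpace X] [MeasurableSpace Y]
    [Bornology Y] (Z : MSProcess P X) (M : RandomMeasure P (univ : Set Y)) (x : X) :
    RealMeasureOn (univ : Set Y) where
  toFun A := cov[Z x, M A; P]
  hasSum_iUnion' A hA hd hb hD := by
    simp only [covariance_L2_eq_inner (Z.memLp x)]
    exact ((M.hasSum_iUnion' A hA hd hb hD).mapL (innerSL ℝ _)).sub
      ((M.mean.hasSum_iUnion' A hA hd hb hD).mul_left _)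

/-- `Z` and `M` are jointly Gaussian: all the vectors
`(Z(x₁), …, Z(xₙ), M(A₁), …, M(Aₘ))` with bounded measurable `Aⱼ` are Gaussian. -/
def JointlyGaussian {X Y : Type*} [TopologicalSpace X] [MeasurableSpace Y] [Bornology Y]
    (Z : MSProcess P X) (M : RandomMeasure P (univ : Set Y)) : Prop :=
  IsGaussianProcess
    (Sum.elim (fun x : X => Z x)
      (fun A : {A : Set Y // MeasurableSet A ∧ IsBounded A} => ⇑(M A.1))) P

/-- `I` is the stochastic integral `∫_D Z dM`, uniquely defined in the `L²` sense: the Riemann sums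
converge to `I` in `L²` along every Riemann system of `D`. -/
def IsStochasticIntegral {X : Type*} [MeasurableSpace X] [PseudoMetricSpace X]
    (Z : MSProcess P X) (M : RandomMeasure P (univ : Set X)) (D : Set X) (I : Lp ℝ 2 P) : Prop :=
  ∀ R : RiemannSystem D,
    Tendsto (fun n => eLpNorm
      (fun ω => ∑ j, Z (R.tag n j) ω * M (R.cell n j) ω - I ω) 2 P) atTop (𝓝 0)

end Stochastic

end SelfIntegral

end

/-!
With `K = K_{Z,M}`, Isserlis' formula turns the inner product of the Riemann sums of `Z dM` over two
partitions into
`∑∑ K(x, I) K(y, J) + ∑∑ C_Z(x, y) C_M(I × J) + ∑∑ K(y, I) K(x, J)`.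
If all three double sums converge as the meshes tend to `0`, then the Riemann sums are Cauchy in
`L²`, and the limit is the second moment of the integrals.

The first sum converges by self-integrability and the second one because `C_Z` is continuous. For
the third one, `K(x, ·)` has a density `g(x) ∈ L²(ν)`, where the finite measure `ν` depends only on
`C_M` and `x ↦ g(x)` is continuous. The third sum is then the inner product in `L²(ν ⊗ ν)` of the
Riemann sums `∑ 1_I ⊗ g(x)` and of the transposes of the Riemann sums `∑ 1_J ⊗ g(y)`. These converge
by the same Cauchy argument: their inner products are the Riemann sums of the continuous function
`⟪g(x), g(y)⟫` for the image of `ν` on the diagonal. Their limit is a function `k ∈ L²(ν ⊗ ν)`, and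
the third sum converges to the integral of `k(x, y) k(y, x)`, which is a measure in its domain.
-/

noncomputable section

namespace SelfIntegral

section GaussianMoments

variable {Ω : Type*} [MeasurableSpace Ω] {P : Measure Ω}

theorem hasDerivAt_exp_mul_sq_div_two_mul (v : ℝ) {f : ℝ → ℝ} {f' t : ℝ}
    (hf : HasDerivAt f f' t) :
    HasDerivAt (fun s => Real.exp (v * s ^ 2 / 2) * f s)
      (Real.exp (v * t ^ 2 / 2) * (v * t * f t + f')) t := by
  have hexp := (((hasDerivAt_pow 2 t).const_mul v).div_const 2).exp
  refine (hexp.mul hf).congr_deriv ?_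
  push_cast
  ring

theorem iteratedDeriv_four_exp_mul_sq_div_two (v : ℝ) :
    iteratedDeriv 4 (fun t : ℝ => Real.exp (v * t ^ 2 / 2)) 0 = 3 * v ^ 2 := by
  have h1 : deriv (fun t : ℝ => Real.exp (v * t ^ 2 / 2))
      = fun t => Real.exp (v * t ^ 2 / 2) * (v * t) := funext fun t => by
    simpa using (hasDerivAt_exp_mul_sq_div_two_mul v (hasDerivAt_const t 1)).deriv
  have h2 : deriv (fun t : ℝ => Real.exp (v * t ^ 2 / 2) * (v * t))
      = fun t => Real.exp (v * t ^ 2 / 2) * (v + v ^ 2 * t ^ 2) := funext fun t => by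
    refine (hasDerivAt_exp_mul_sq_div_two_mul v ((hasDerivAt_id t).const_mul v)).deriv.trans ?_
    simp only [id_eq]
    ring
  have h3 : deriv (fun t : ℝ => Real.exp (v * t ^ 2 / 2) * (v + v ^ 2 * t ^ 2))
      = fun t => Real.exp (v * t ^ 2 / 2) * (3 * v ^ 2 * t + v ^ 3 * t ^ 3) := funext fun t => by
    refine (hasDerivAt_exp_mul_sq_div_two_mul v
      (((hasDerivAt_pow 2 t).const_mul (v ^ 2)).const_add v)).deriv.trans ?_
    push_cast
    ring
  have h4 : deriv (fun t : ℝ => Real.exp (v * t ^ 2 / 2) * (3 * v ^ 2 * t + v ^ 3 * t ^ 3)) 0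
      = 3 * v ^ 2 := by
    refine (hasDerivAt_exp_mul_sq_div_two_mul v (((hasDerivAt_id 0).const_mul (3 * v ^ 2)).add
      ((hasDerivAt_pow 3 0).const_mul (v ^ 3)))).deriv.trans ?_
    simp
  rw [iteratedDeriv_succ, iteratedDeriv_succ, iteratedDeriv_succ, iteratedDeriv_one, h1, h2, h3, h4]

theorem integral_pow_four_gaussianReal (v : NNReal) :
    ∫ x, x ^ 4 ∂(gaussianReal 0 v) = 3 * (v : ℝ) ^ 2 := by
  have h := iteratedDeriv_mgf_zero (X := id) (μ := gaussianReal 0 v)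
    (by simp [integrableExpSet_id_gaussianReal]) 4
  rw [mgf_id_gaussianReal] at h
  simp only [zero_mul, zero_add, iteratedDeriv_four_exp_mul_sq_div_two] at h
  simpa using h.symm

theorem integral_pow_four_of_hasGaussianLaw {Y : Ω → ℝ} (hY : HasGaussianLaw Y P)
    (h0 : P[Y] = 0) : P[Y ^ 4] = 3 * P[Y ^ 2] ^ 2 := by
  have hm := hY.aemeasurable
  have hlaw : P.map Y = gaussianReal 0 Var[Y; P].toNNReal := by rw [hY.map_eq_gaussianReal, h0]
  calc P[Y ^ 4] = ∫ x, x ^ 4 ∂(P.map Y) :=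
        (integral_map hm (f := (· ^ 4)) (by fun_prop)).symm
    _ = 3 * Var[Y; P] ^ 2 := by
      rw [hlaw, integral_pow_four_gaussianReal, Real.coe_toNNReal _ (variance_nonneg _ _)]
    _ = 3 * P[Y ^ 2] ^ 2 := by rw [variance_of_integral_eq_zero hm h0]; rfl

/-- A linear space of centred Gaussian random variables: these are jointly Gaussian, since all their
linear combinations are Gaussian. -/
structure IsCentredGaussianSpace (V : Submodule ℝ (Ω → ℝ)) (P : Measure Ω) : Prop where
  hasGaussianLaw : ∀ f ∈ V, HasGaussianLaw f P
  integral_eq_zero : ∀ f ∈ V, P[f] = 0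

namespace IsCentredGaussianSpace

variable {V : Submodule ℝ (Ω → ℝ)} {a b c d : Ω → ℝ}

theorem memLp_mul (hV : IsCentredGaussianSpace V P) (ha : a ∈ V) (hb : b ∈ V) :
    MemLp (a * b) 2 P := by
  have h4 : ∀ f ∈ V, MemLp f 4 P := fun f hf => (hV.hasGaussianLaw f hf).memLp (by norm_num)
  have : ENNReal.HolderTriple 4 4 2 := ⟨by
    rw [← two_mul, show (4 : ℝ≥0∞) = 2 * 2 by norm_num,
      ENNReal.mul_inv (by norm_num) (by norm_num), ← mul_assoc,
      ENNReal.mul_inv_cancel (by norm_num) (by norm_num), one_mul]⟩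
  exact (h4 b hb).mul (h4 a ha)

theorem integrable_mul (hV : IsCentredGaussianSpace V P) (ha : a ∈ V) (hb : b ∈ V) :
    Integrable (a * b) P :=
  ((hV.hasGaussianLaw a ha).memLp_two).integrable_mul (hV.hasGaussianLaw b hb).memLp_two

theorem integrable_mul_mul (hV : IsCentredGaussianSpace V P) (ha : a ∈ V) (hb : b ∈ V)
    (hc : c ∈ V) (hd : d ∈ V) : Integrable (a * b * (c * d)) P :=
  (hV.memLp_mul ha hb).integrable_mul (hV.memLp_mul hc hd)

theorem integral_mul_add (hV : IsCentredGaussianSpace V P) (ha : a ∈ V) (hb : b ∈ V)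
    (hc : c ∈ V) : P[a * (b + c)] = P[a * b] + P[a * c] := by
  rw [mul_add, integral_add' (hV.integrable_mul ha hb) (hV.integrable_mul ha hc)]

theorem integral_mul_sub (hV : IsCentredGaussianSpace V P) (ha : a ∈ V) (hb : b ∈ V)
    (hc : c ∈ V) : P[a * (b - c)] = P[a * b] - P[a * c] := by
  rw [mul_sub, integral_sub' (hV.integrable_mul ha hb) (hV.integrable_mul ha hc)]

theorem integral_add_sq (hV : IsCentredGaussianSpace V P) (ha : a ∈ V) (hb : b ∈ V) :
    P[(a + b) ^ 2] = P[a ^ 2] + 2 * P[a * b] + P[b ^ 2] := by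
  rw [sq, hV.integral_mul_add (V.add_mem ha hb) ha hb, mul_comm _ a, mul_comm _ b,
    hV.integral_mul_add ha ha hb, hV.integral_mul_add hb ha hb, mul_comm b a, ← sq, ← sq]
  ring

theorem integral_sub_sq (hV : IsCentredGaussianSpace V P) (ha : a ∈ V) (hb : b ∈ V) :
    P[(a - b) ^ 2] = P[a ^ 2] - 2 * P[a * b] + P[b ^ 2] := by
  rw [sq, hV.integral_mul_sub (V.sub_mem ha hb) ha hb, mul_comm _ a, mul_comm _ b,
    hV.integral_mul_sub ha ha hb, hV.integral_mul_sub hb ha hb, mul_comm b a, ← sq, ← sq]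
  ring

theorem integral_pow_four (hV : IsCentredGaussianSpace V P) (ha : a ∈ V) :
    P[a ^ 4] = 3 * P[a ^ 2] ^ 2 :=
  integral_pow_four_of_hasGaussianLaw (hV.hasGaussianLaw a ha) (hV.integral_eq_zero a ha)

theorem integrable_pow_four (hV : IsCentredGaussianSpace V P) (ha : a ∈ V) :
    Integrable (a ^ 4) P := by
  simpa only [show a ^ 4 = a * a * (a * a) by ring] using hV.integrable_mul_mul ha ha ha ha

theorem integrable_mul_mul_sq (hV : IsCentredGaussianSpace V P) (ha : a ∈ V) (hb : b ∈ V)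
    (hc : c ∈ V) : Integrable (a * b * c ^ 2) P := by
  simpa only [sq] using hV.integrable_mul_mul ha hb hc hc

theorem integral_sq_mul_sq (hV : IsCentredGaussianSpace V P) (ha : a ∈ V) (hb : b ∈ V) :
    P[a ^ 2 * b ^ 2] = P[a ^ 2] * P[b ^ 2] + 2 * P[a * b] ^ 2 := by
  have hI : Integrable (a ^ 2 * b ^ 2) P := by
    simpa only [sq a] using hV.integrable_mul_mul_sq ha ha hb
  have ha4 := (hV.integrable_pow_four ha).const_mul 2
  have hb4 := (hV.integrable_pow_four hb).const_mul 2
  have polarization : P[(a + b) ^ 4] + P[(a - b) ^ 4]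
      = 2 * P[a ^ 4] + 12 * P[a ^ 2 * b ^ 2] + 2 * P[b ^ 4] := by
    rw [← integral_add (hV.integrable_pow_four (V.add_mem ha hb))
      (hV.integrable_pow_four (V.sub_mem ha hb)), ← integral_const_mul, ← integral_const_mul,
      ← integral_const_mul, ← integral_add' ha4 (hI.const_mul 12),
      ← integral_add' (ha4.add (hI.const_mul 12)) hb4]
    congr 1 with ω
    simp only [Pi.add_apply, Pi.sub_apply, Pi.mul_apply, Pi.pow_apply]
    ring
  rw [hV.integral_pow_four (V.add_mem ha hb), hV.integral_pow_four (V.sub_mem ha hb),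
    hV.integral_pow_four ha, hV.integral_pow_four hb, hV.integral_add_sq ha hb,
    hV.integral_sub_sq ha hb] at polarization
  linarith

theorem integral_mul_mul_sq (hV : IsCentredGaussianSpace V P) (ha : a ∈ V) (hb : b ∈ V)
    (hc : c ∈ V) : P[a * b * c ^ 2] = P[a * b] * P[c ^ 2] + 2 * (P[a * c] * P[b * c]) := by
  have hI {f} (hf : f ∈ V) : Integrable (f ^ 2 * c ^ 2) P := by
    simpa only [sq f] using hV.integrable_mul_mul_sq hf hf hc
  have polarization : 4 * P[a * b * c ^ 2] = P[(a + b) ^ 2 * c ^ 2] - P[(a - b) ^ 2 * c ^ 2] := by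
    rw [← integral_sub (hI (V.add_mem ha hb)) (hI (V.sub_mem ha hb)), ← integral_const_mul]
    congr 1 with ω
    simp only [Pi.add_apply, Pi.sub_apply, Pi.mul_apply, Pi.pow_apply]
    ring
  rw [hV.integral_sq_mul_sq (V.add_mem ha hb) hc, hV.integral_sq_mul_sq (V.sub_mem ha hb) hc,
    hV.integral_add_sq ha hb, hV.integral_sub_sq ha hb, mul_comm (a + b), mul_comm (a - b),
    hV.integral_mul_add hc ha hb, hV.integral_mul_sub hc ha hb] at polarization
  rw [mul_comm a c, mul_comm b c]
  linarith

theorem isserlis (hV : IsCentredGaussianSpace V P) (ha : a ∈ V) (hb : b ∈ V)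
    (hc : c ∈ V) (hd : d ∈ V) :
    P[a * b * (c * d)]
      = P[a * b] * P[c * d] + P[a * c] * P[b * d] + P[a * d] * P[b * c] := by
  have polarization :
      4 * P[a * b * (c * d)] = P[a * b * (c + d) ^ 2] - P[a * b * (c - d) ^ 2] := by
    rw [← integral_sub (hV.integrable_mul_mul_sq ha hb (V.add_mem hc hd))
      (hV.integrable_mul_mul_sq ha hb (V.sub_mem hc hd)), ← integral_const_mul]
    congr 1 with ω
    simp only [Pi.add_apply, Pi.sub_apply, Pi.mul_apply, Pi.pow_apply]
    ring
  rw [hV.integral_mul_mul_sq ha hb (V.add_mem hc hd),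
    hV.integral_mul_mul_sq ha hb (V.sub_mem hc hd), hV.integral_add_sq hc hd,
    hV.integral_sub_sq hc hd, hV.integral_mul_add ha hc hd, hV.integral_mul_add hb hc hd,
    hV.integral_mul_sub ha hc hd, hV.integral_mul_sub hb hc hd] at polarization
  linarith

end IsCentredGaussianSpace

theorem isCentredGaussianSpace_span {T : Type*} {X : T → Ω → ℝ} (hX : IsGaussianProcess X P)
    (h0 : ∀ t, P[X t] = 0) : IsCentredGaussianSpace (Submodule.span ℝ (range X)) P where
  hasGaussianLaw f hf := by
    obtain ⟨c, rfl⟩ := Finsupp.mem_span_range_iff_exists_finsupp.1 hf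
    simpa [Finsupp.sum, Finset.sum_fn] using
      (hX.smul c).hasGaussianLaw_fun_sum (I := c.support)
  integral_eq_zero f hf := by
    obtain ⟨c, rfl⟩ := Finsupp.mem_span_range_iff_exists_finsupp.1 hf
    simp only [Finsupp.sum, Finset.sum_apply, Pi.smul_apply, smul_eq_mul]
    rw [integral_finsetSum _ fun t _ => (hX.hasGaussianLaw_eval t).integrable.const_mul (c t)]
    simp only [integral_const_mul, h0, mul_zero, Finset.sum_const_zero]

end GaussianMoments

/-- A finite measurable partition of `A` with a tag in every cell. -/
structure TaggedPartition {X : Type*} [MeasurableSpace X] (A : Set X) where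
  card : ℕ
  cell : Fin card → Set X
  tag : Fin card → X
  measurableSet_cell : ∀ j, MeasurableSet (cell j)
  disjoint_cell : Pairwise (Disjoint on cell)
  iUnion_cell : (⋃ j, cell j) = A
  tag_mem : ∀ j, tag j ∈ cell j

namespace TaggedPartition

section Constructions

variable {X Y V : Type*} [MeasurableSpace X] [MeasurableSpace Y] [AddCommMonoid V]
  {A B C : Set X}

theorem cell_subset (p : TaggedPartition A) (j : Fin p.card) : p.cell j ⊆ A :=
  (subset_iUnion p.cell j).trans p.iUnion_cell.subset

theorem tag_mem_set (p : TaggedPartition A) (j : Fin p.card) : p.tag j ∈ A :=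
  p.cell_subset j (p.tag_mem j)

/-- The Riemann sum of `F` along a tagged partition. -/
def sum (p : TaggedPartition A) (F : X → Set X → V) : V :=
  ∑ j, F (p.tag j) (p.cell j)

theorem sum_congr (p : TaggedPartition A) {F G : X → Set X → V}
    (h : ∀ x I, MeasurableSet I → I ⊆ A → x ∈ I → F x I = G x I) : p.sum F = p.sum G :=
  Finset.sum_congr rfl fun j _ => h _ _ (p.measurableSet_cell j) (p.cell_subset j) (p.tag_mem j)

/-- A tagged partition with cells indexed by a finite type. -/
def ofFintype {ι : Type*} [Fintype ι] (cell : ι → Set X) (tag : ι → X)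
    (hm : ∀ i, MeasurableSet (cell i)) (hd : Pairwise (Disjoint on cell))
    (hU : (⋃ i, cell i) = A) (ht : ∀ i, tag i ∈ cell i) : TaggedPartition A where
  card := Fintype.card ι
  cell j := cell ((Fintype.equivFin ι).symm j)
  tag j := tag ((Fintype.equivFin ι).symm j)
  measurableSet_cell _ := hm _
  disjoint_cell _ _ hij := hd ((Fintype.equivFin ι).symm.injective.ne hij)
  iUnion_cell := by
    rw [← hU]
    exact (Fintype.equivFin ι).symm.surjective.iUnion_comp cell
  tag_mem _ := ht _

theorem sum_ofFintype {ι : Type*} [Fintype ι] (cell : ι → Set X) (tag : ι → X)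
    (hm : ∀ i, MeasurableSet (cell i)) (hd : Pairwise (Disjoint on cell))
    (hU : (⋃ i, cell i) = A) (ht : ∀ i, tag i ∈ cell i) (F : X → Set X → V) :
    (ofFintype cell tag hm hd hU ht).sum F = ∑ i, F (tag i) (cell i) :=
  (Fintype.equivFin ι).symm.sum_comp fun i => F (tag i) (cell i)

theorem pairwise_disjoint_sumElim (p : TaggedPartition A) (q : TaggedPartition B)
    (hAB : Disjoint A B) : Pairwise (Disjoint on Sum.elim p.cell q.cell) := by
  rintro (i | i) (j | j) hij
  · exact p.disjoint_cell fun h => hij (congrArg _ h)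
  · exact hAB.mono (p.cell_subset i) (q.cell_subset j)
  · exact hAB.symm.mono (q.cell_subset i) (p.cell_subset j)
  · exact q.disjoint_cell fun h => hij (congrArg _ h)

/-- The union of tagged partitions of two disjoint sets. -/
def union (p : TaggedPartition A) (q : TaggedPartition B) (hAB : Disjoint A B)
    (hC : A ∪ B = C) : TaggedPartition C :=
  ofFintype (Sum.elim p.cell q.cell) (Sum.elim p.tag q.tag)
    (by rintro (i | i); exacts [p.measurableSet_cell i, q.measurableSet_cell i])
    (p.pairwise_disjoint_sumElim q hAB)
    (by simp [iUnion_sum, p.iUnion_cell, q.iUnion_cell, hC])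
    (by rintro (i | i); exacts [p.tag_mem i, q.tag_mem i])

theorem sum_union (p : TaggedPartition A) (q : TaggedPartition B)
    (hAB : Disjoint A B) (hC : A ∪ B = C) (F : X → Set X → V) :
    (p.union q hAB hC).sum F = p.sum F + q.sum F := by
  rw [union, sum_ofFintype, Fintype.sum_sum_type]
  rfl

theorem pairwise_disjoint_prod {B : Set Y} (p : TaggedPartition A) (q : TaggedPartition B) :
    Pairwise (Disjoint on fun i : Fin p.card × Fin q.card => p.cell i.1 ×ˢ q.cell i.2) := by
  rintro ⟨i, k⟩ ⟨j, l⟩ hij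
  rcases eq_or_ne i j with rfl | h
  · exact Disjoint.set_prod_right (q.disjoint_cell fun h => hij (congrArg _ h)) _ _
  · exact Disjoint.set_prod_left (p.disjoint_cell h) _ _

/-- The product of two tagged partitions. -/
def prod {B : Set Y} (p : TaggedPartition A) (q : TaggedPartition B) :
    TaggedPartition (A ×ˢ B) :=
  ofFintype (fun i : Fin p.card × Fin q.card => p.cell i.1 ×ˢ q.cell i.2)
    (fun i => (p.tag i.1, q.tag i.2))
    (fun i => (p.measurableSet_cell i.1).prod (q.measurableSet_cell i.2))
    (p.pairwise_disjoint_prod q)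
    (by rw [iUnion_prod, p.iUnion_cell, q.iUnion_cell])
    (fun i => mk_mem_prod (p.tag_mem i.1) (q.tag_mem i.2))

theorem sum_prod {B : Set Y} (p : TaggedPartition A) (q : TaggedPartition B)
    (H : X × Y → Set (X × Y) → V) :
    (p.prod q).sum H = p.sum fun x I => q.sum fun y J => H (x, y) (I ×ˢ J) := by
  rw [prod, sum_ofFintype, Fintype.sum_prod_type]
  rfl

/-- The trace of a tagged partition on a measurable set that contains all the tags. -/
def restrict (p : TaggedPartition A) (hB : MeasurableSet B) (hBA : B ⊆ A)
    (ht : ∀ j, p.tag j ∈ B) : TaggedPartition B where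
  card := p.card
  cell j := p.cell j ∩ B
  tag := p.tag
  measurableSet_cell j := (p.measurableSet_cell j).inter hB
  disjoint_cell _ _ hij := (p.disjoint_cell hij).mono inter_subset_left inter_subset_left
  iUnion_cell := by rw [← iUnion_inter, p.iUnion_cell, inter_eq_right.2 hBA]
  tag_mem j := ⟨p.tag_mem j, ht j⟩

end Constructions

section Mesh

variable {X Y : Type*} [MeasurableSpace X] [PseudoEMetricSpace X] [MeasurableSpace Y]
  [PseudoEMetricSpace Y] {A B C : Set X}

/-- The mesh of a tagged partition: the largest diameter of a cell. -/
def mesh (p : TaggedPartition A) : ℝ≥0∞ := ⨆ j, Metric.ediam (p.cell j)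

theorem ediam_cell_le (p : TaggedPartition A) (j : Fin p.card) :
    Metric.ediam (p.cell j) ≤ p.mesh :=
  le_iSup (fun j => Metric.ediam (p.cell j)) j

theorem edist_tag_le (p : TaggedPartition A) {j : Fin p.card} {x : X} (hx : x ∈ p.cell j) :
    edist (p.tag j) x ≤ p.mesh :=
  (Metric.edist_le_ediam_of_mem (p.tag_mem j) hx).trans (p.ediam_cell_le j)

theorem mesh_ofFintype {ι : Type*} [Fintype ι] (cell : ι → Set X)
    (tag : ι → X) (hm : ∀ i, MeasurableSet (cell i)) (hd : Pairwise (Disjoint on cell))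
    (hU : (⋃ i, cell i) = A) (ht : ∀ i, tag i ∈ cell i) :
    (ofFintype cell tag hm hd hU ht).mesh = ⨆ i, Metric.ediam (cell i) :=
  (Fintype.equivFin ι).symm.surjective.iSup_comp fun i => Metric.ediam (cell i)

theorem mesh_union (p : TaggedPartition A) (q : TaggedPartition B)
    (hAB : Disjoint A B) (hC : A ∪ B = C) : (p.union q hAB hC).mesh = p.mesh ⊔ q.mesh := by
  rw [union, mesh_ofFintype, iSup_sum]
  rfl

theorem mesh_prod_le {B : Set Y} (p : TaggedPartition A) (q : TaggedPartition B) :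
    (p.prod q).mesh ≤ p.mesh ⊔ q.mesh := by
  rw [prod, mesh_ofFintype]
  refine iSup_le fun i => Metric.ediam_le fun z hz w hw => ?_
  exact max_le_max ((Metric.edist_le_ediam_of_mem hz.1 hw.1).trans (p.ediam_cell_le i.1))
    ((Metric.edist_le_ediam_of_mem hz.2 hw.2).trans (q.ediam_cell_le i.2))

theorem mesh_restrict_le (p : TaggedPartition A) (hB : MeasurableSet B) (hBA : B ⊆ A)
    (ht : ∀ j, p.tag j ∈ B) : (p.restrict hB hBA ht).mesh ≤ p.mesh :=
  iSup_mono fun _ => Metric.ediam_mono inter_subset_left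

end Mesh

end TaggedPartition

section Fine

variable {X Y : Type*} [MeasurableSpace X] [PseudoEMetricSpace X] [MeasurableSpace Y]
  [PseudoEMetricSpace Y] {A B C : Set X}

/-- The filter of arbitrarily fine tagged partitions of `A`: convergence along all Riemann systems
of `A` is convergence along this filter. -/
def fine (A : Set X) : Filter (TaggedPartition A) := comap TaggedPartition.mesh (𝓝 0)

instance : (fine A).IsCountablyGenerated := by unfold fine; infer_instance

theorem tendsto_fine_iff {α : Type*} {l : Filter α} {f : α → TaggedPartition A} :
    Tendsto f l (fine A) ↔ Tendsto (fun a => (f a).mesh) l (𝓝 0) := tendsto_comap_iff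

theorem eventually_fine_iff {Q : TaggedPartition A → Prop} :
    (∀ᶠ p in fine A, Q p) ↔ ∃ δ > 0, ∀ p : TaggedPartition A, p.mesh ≤ δ → Q p := by
  simpa [fine] using (ENNReal.nhds_zero_basis_Iic.comap TaggedPartition.mesh).eventually_iff

theorem eventually_mesh_le {δ : ℝ≥0∞} (hδ : 0 < δ) : ∀ᶠ p in fine A, p.mesh ≤ δ :=
  eventually_fine_iff.2 ⟨δ, hδ, fun _ h => h⟩

theorem tendsto_mesh_sup_mesh {B : Set Y} :
    Tendsto (fun pq : TaggedPartition A × TaggedPartition B => pq.1.mesh ⊔ pq.2.mesh)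
      (fine A ×ˢ fine B) (𝓝 0) := by
  simpa using (tendsto_fine_iff.1 (tendsto_fst (f := fine A) (g := fine B))).sup_nhds
    (tendsto_fine_iff.1 tendsto_snd)

theorem tendsto_union (hAB : Disjoint A B) (hC : A ∪ B = C) :
    Tendsto (fun pq : TaggedPartition A × TaggedPartition B => pq.1.union pq.2 hAB hC)
      (fine A ×ˢ fine B) (fine C) := by
  simpa only [tendsto_fine_iff, TaggedPartition.mesh_union] using tendsto_mesh_sup_mesh

theorem tendsto_prod {B : Set Y} :
    Tendsto (fun pq : TaggedPartition A × TaggedPartition B => pq.1.prod pq.2)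
      (fine A ×ˢ fine B) (fine (A ×ˢ B)) :=
  tendsto_fine_iff.2 <| tendsto_of_tendsto_of_tendsto_of_le_of_le tendsto_const_nhds
    tendsto_mesh_sup_mesh (fun _ => zero_le) fun pq => pq.1.mesh_prod_le pq.2

/-- The tagged partitions of a Riemann system. -/
def RiemannSystem.partition (R : RiemannSystem A) (n : ℕ) : TaggedPartition A where
  card := R.card n
  cell := R.cell n
  tag := R.tag n
  measurableSet_cell := R.measurableSet_cell n
  disjoint_cell := R.disjoint_cell n
  iUnion_cell := R.iUnion_cell n
  tag_mem := R.tag_mem n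

theorem RiemannSystem.tendsto_partition (R : RiemannSystem A) :
    Tendsto R.partition atTop (fine A) :=
  tendsto_fine_iff.2 R.tendsto_mesh

/-- The Riemann system of a sequence of finer and finer tagged partitions. -/
def RiemannSystem.ofSeq (p : ℕ → TaggedPartition A) (hp : Tendsto p atTop (fine A)) :
    RiemannSystem A where
  card n := (p n).card
  cell n := (p n).cell
  tag n := (p n).tag
  measurableSet_cell n := (p n).measurableSet_cell
  disjoint_cell n := (p n).disjoint_cell
  iUnion_cell n := (p n).iUnion_cell
  tag_mem n := (p n).tag_mem
  tendsto_mesh := tendsto_fine_iff.1 hp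

theorem forall_riemannSystem_tendsto_iff {β : Type*} {f : TaggedPartition A → β} {l : Filter β} :
    (∀ R : RiemannSystem A, Tendsto (fun n => f (R.partition n)) atTop l) ↔
      Tendsto f (fine A) l :=
  ⟨fun h => tendsto_of_seq_tendsto fun p hp => h (RiemannSystem.ofSeq p hp),
    fun h R => h.comp R.tendsto_partition⟩

theorem isSelfIntegral_iff_tendsto {K : X → Set X → ℝ} {l : ℝ} :
    IsSelfIntegral K A l ↔ Tendsto (fun p : TaggedPartition A => p.sum K) (fine A) (𝓝 l) :=
  forall_riemannSystem_tendsto_iff (f := fun p => p.sum K)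

theorem isQuasiSelfIntegral_iff_tendsto {H : X × X → Set (X × X) → ℝ} {l : ℝ} :
    IsQuasiSelfIntegral H A B l ↔
      Tendsto (fun pq : TaggedPartition A × TaggedPartition B => (pq.1.prod pq.2).sum H)
        (fine A ×ˢ fine B) (𝓝 l) := by
  simp only [TaggedPartition.sum_prod]
  refine ⟨fun h => tendsto_of_seq_tendsto fun p hp => ?_, fun h R S => ?_⟩
  · exact (h (RiemannSystem.ofSeq _ (tendsto_fst.comp hp))
      (RiemannSystem.ofSeq _ (tendsto_snd.comp hp))).comp (tendsto_id.prodMk tendsto_id)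
  · exact h.comp (R.tendsto_partition.prodMap S.tendsto_partition)

theorem exists_disjoint_measurableSet_cover_ediam_le [OpensMeasurableSpace X]
    (hA : TotallyBounded A) {δ : ℝ≥0∞} (hδ : 0 < δ) :
    ∃ (n : ℕ) (c : Fin n → Set X), (∀ i, MeasurableSet (c i)) ∧ Pairwise (Disjoint on c) ∧
      (∀ i, Metric.ediam (c i) ≤ δ) ∧ A ⊆ ⋃ i, c i := by
  obtain ⟨t, htf, hcov⟩ := EMetric.totallyBounded_iff.1 hA (δ / 2) (ENNReal.half_pos hδ.ne')
  obtain ⟨n, e, -, rfl⟩ := htf.fin_param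
  let b : Fin n → Set X := fun i => Metric.eball (e i) (δ / 2)
  have hb : ∀ i, MeasurableSet (b i) := fun i => Metric.isOpen_eball.measurableSet
  refine ⟨n, disjointed b, fun i => disjointedRec (fun _ j hs => hs.diff (hb j)) (hb i),
    disjoint_disjointed b, fun i => ?_, ?_⟩
  · exact (Metric.ediam_mono (disjointed_subset b i)).trans <|
      Metric.ediam_eball_le.trans (ENNReal.mul_div_cancel (by norm_num) (by norm_num)).le
  · rw [iUnion_disjointed]
    simpa [b] using hcov

theorem exists_taggedPartition_mesh_le [OpensMeasurableSpace X] (hA : MeasurableSet A)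
    (ht : TotallyBounded A) {δ : ℝ≥0∞} (hδ : 0 < δ) : ∃ p : TaggedPartition A, p.mesh ≤ δ := by
  classical
  obtain ⟨n, c, hcm, hcd, hc, hAc⟩ := exists_disjoint_measurableSet_cover_ediam_le ht hδ
  let ι := {i // (A ∩ c i).Nonempty}
  have hU : (⋃ i : ι, A ∩ c i) = A := by
    refine (iUnion_subset fun i => inter_subset_left).antisymm fun x hx => ?_
    obtain ⟨i, hi⟩ := mem_iUnion.1 (hAc hx)
    exact mem_iUnion.2 ⟨⟨i, x, hx, hi⟩, hx, hi⟩
  have hd : Pairwise (Disjoint on fun i : ι => A ∩ c i) := fun i j hij =>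
    (hcd (Subtype.coe_ne_coe.2 hij)).mono inter_subset_right inter_subset_right
  refine ⟨TaggedPartition.ofFintype (ι := ι) (fun i => A ∩ c i) (fun i => i.2.some)
    (fun i => hA.inter (hcm i)) hd hU (fun i => i.2.some_mem), ?_⟩
  rw [TaggedPartition.mesh_ofFintype]
  exact iSup_le fun i => (Metric.ediam_mono inter_subset_right).trans (hc i)

theorem neBot_fine [OpensMeasurableSpace X] (hA : MeasurableSet A) (ht : TotallyBounded A) :
    (fine A).NeBot := by
  refine ENNReal.nhds_zero_basis_Iic.comap TaggedPartition.mesh |>.neBot_iff.2 fun {δ} hδ => ?_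
  obtain ⟨p, hp⟩ := exists_taggedPartition_mesh_le hA ht hδ
  exact ⟨p, hp⟩

end Fine

section RiemannIntegral

variable {X V : Type*} [MeasurableSpace X] [PseudoEMetricSpace X] [NormedAddCommGroup V]
  {F : X → Set X → V} {A B D : Set X}

/-- The Riemann sums of the `V`-valued kernel `F` over `A` converge. -/
def RiemannIntegrable (F : X → Set X → V) (A : Set X) : Prop :=
  ∃ v, Tendsto (fun p : TaggedPartition A => p.sum F) (fine A) (𝓝 v)

/-- The Riemann integral `∫_A F(x, dx)` of a `V`-valued kernel, with a junk value if the Riemann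
sums do not converge. -/
def riemannIntegral (F : X → Set X → V) (A : Set X) : V :=
  limUnder (fine A) fun p => p.sum F

theorem RiemannIntegrable.tendsto (h : RiemannIntegrable F A) :
    Tendsto (fun p : TaggedPartition A => p.sum F) (fine A) (𝓝 (riemannIntegral F A)) :=
  tendsto_nhds_limUnder h

theorem riemannIntegrable_congr {G : X → Set X → V}
    (h : ∀ x I, MeasurableSet I → I ⊆ A → x ∈ I → F x I = G x I) :
    RiemannIntegrable F A ↔ RiemannIntegrable G A := by
  rw [RiemannIntegrable, RiemannIntegrable, funext fun p : TaggedPartition A => p.sum_congr h]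

theorem riemannIntegral_congr {G : X → Set X → V}
    (h : ∀ x I, MeasurableSet I → I ⊆ A → x ∈ I → F x I = G x I) :
    riemannIntegral F A = riemannIntegral G A := by
  rw [riemannIntegral, riemannIntegral, funext fun p : TaggedPartition A => p.sum_congr h]

theorem selfIntegrable_iff_riemannIntegrable {K : X → Set X → ℝ} [(fine A).NeBot] :
    SelfIntegrable K A ↔ RiemannIntegrable K A := by
  simp only [SelfIntegrable, isSelfIntegral_iff_tendsto]
  exact ⟨fun h => h.exists, fun ⟨l, hl⟩ => ⟨l, hl, fun _ h => tendsto_nhds_unique h hl⟩⟩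

theorem RiemannIntegrable.riemannIntegral_union [(fine A).NeBot] [(fine B).NeBot]
    (hA : RiemannIntegrable F A) (hB : RiemannIntegrable F B) (hU : RiemannIntegrable F (A ∪ B))
    (hAB : Disjoint A B) :
    riemannIntegral F (A ∪ B) = riemannIntegral F A + riemannIntegral F B := by
  refine tendsto_nhds_unique (hU.tendsto.comp (tendsto_union hAB rfl)) ?_
  simp only [Function.comp_def, TaggedPartition.sum_union]
  exact (hA.tendsto.comp tendsto_fst).add (hB.tendsto.comp tendsto_snd)

section Map

variable [NormedSpace ℝ V] {W : Type*} [NormedAddCommGroup W] [NormedSpace ℝ W]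

theorem RiemannIntegrable.tendsto_map (h : RiemannIntegrable F A) (L : V →L[ℝ] W) :
    Tendsto (fun p : TaggedPartition A => p.sum fun x I => L (F x I)) (fine A)
      (𝓝 (L (riemannIntegral F A))) := by
  refine ((L.continuous.tendsto _).comp h.tendsto).congr fun p => ?_
  exact map_sum L _ _

theorem RiemannIntegrable.map (h : RiemannIntegrable F A) (L : V →L[ℝ] W) :
    RiemannIntegrable (fun x I => L (F x I)) A :=
  ⟨_, h.tendsto_map L⟩

theorem RiemannIntegrable.riemannIntegral_map [(fine A).NeBot] (h : RiemannIntegrable F A)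
    (L : V →L[ℝ] W) :
    riemannIntegral (fun x I => L (F x I)) A = L (riemannIntegral F A) :=
  tendsto_nhds_unique (h.map L).tendsto (h.tendsto_map L)

end Map

theorem RiemannIntegrable.tendsto_inner {H : Type*} [NormedAddCommGroup H]
    [InnerProductSpace ℝ H] {F G : X → Set X → H} (hF : RiemannIntegrable F A)
    (hG : RiemannIntegrable G B) :
    Tendsto (fun pq : TaggedPartition A × TaggedPartition B =>
      pq.1.sum fun x I => pq.2.sum fun y J => inner ℝ (F x I) (G y J)) (fine A ×ˢ fine B)
      (𝓝 (inner ℝ (riemannIntegral F A) (riemannIntegral G B))) := by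
  refine ((hF.tendsto.comp tendsto_fst).inner (𝕜 := ℝ) (hG.tendsto.comp tendsto_snd)).congr
    fun pq => ?_
  simp only [Function.comp_apply, TaggedPartition.sum, inner_sum, sum_inner]
  exact Finset.sum_comm

theorem riemannIntegral_empty [OpensMeasurableSpace X] (F : X → Set X → V) :
    riemannIntegral F ∅ = 0 := by
  have hF : (fun p : TaggedPartition (∅ : Set X) => p.sum F) = fun _ => 0 := funext fun p =>
    Finset.sum_eq_zero fun j _ => (p.tag_mem_set j).elim
  have := neBot_fine (X := X) .empty totallyBounded_empty
  rw [riemannIntegral, hF]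
  exact tendsto_const_nhds.limUnder_eq

section Complete

variable [CompleteSpace V] [OpensMeasurableSpace X]

theorem RiemannIntegrable.mono (h : RiemannIntegrable F D) (hD : MeasurableSet D)
    (ht : TotallyBounded D) (hA : MeasurableSet A) (hAD : A ⊆ D) : RiemannIntegrable F A := by
  have := neBot_fine hA (ht.subset hAD)
  have := neBot_fine (hD.diff hA) (ht.subset sdiff_subset)
  obtain ⟨v, hv⟩ := h
  have hU : A ∪ D \ A = D := union_sdiff_cancel hAD
  have hsum := hv.comp (tendsto_union disjoint_sdiff_right hU)
  simp only [Function.comp_def, TaggedPartition.sum_union] at hsum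
  refine cauchy_map_iff_exists_tendsto.1 (Metric.cauchy_iff.2 ⟨inferInstance, fun ε hε => ?_⟩)
  -- A common fine partition of `D \ A` extends two fine partitions of `A` to partitions of `D`.
  obtain ⟨q, hq⟩ := ((eventually_swap_iff.1
    (Metric.tendsto_nhds.1 hsum (ε / 2) (half_pos hε))).curry).exists
  refine ⟨_, image_mem_map hq, ?_⟩
  rintro _ ⟨p, hp, rfl⟩ _ ⟨p', hp', rfl⟩
  simpa using (dist_triangle_right _ _ v).trans_lt (add_lt_add hp hp')

theorem RiemannIntegrable.riemannIntegral_diff (h : RiemannIntegrable F D) (hD : MeasurableSet D)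
    (ht : TotallyBounded D) (hA : MeasurableSet A) (hAD : A ⊆ D) :
    riemannIntegral F (D \ A) = riemannIntegral F D - riemannIntegral F A := by
  have := neBot_fine hA (ht.subset hAD)
  have := neBot_fine (hD.diff hA) (ht.subset sdiff_subset)
  have hU := sdiff_union_of_subset hAD
  rw [eq_sub_iff_add_eq, ← (h.mono hD ht (hD.diff hA) sdiff_subset).riemannIntegral_union
    (h.mono hD ht hA hAD) (hU.symm ▸ h) disjoint_sdiff_left, hU]

theorem RiemannIntegrable.exists_mesh_forall_dist_le (h : RiemannIntegrable F D)
    (hD : MeasurableSet D) (ht : TotallyBounded D) {ε : ℝ} (hε : 0 < ε) :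
    ∃ δ > 0, ∀ A, MeasurableSet A → A ⊆ D → ∀ p : TaggedPartition A, p.mesh ≤ δ →
      dist (p.sum F) (riemannIntegral F A) ≤ ε := by
  obtain ⟨δ, hδ, hdist⟩ := eventually_fine_iff.1 (Metric.tendsto_nhds.1 h.tendsto ε hε)
  refine ⟨δ, hδ, fun A hA hAD p hp => ?_⟩
  have := neBot_fine (hD.diff hA) (ht.subset sdiff_subset)
  have hlim : Tendsto (fun q : TaggedPartition (D \ A) => dist (p.sum F + q.sum F)
      (riemannIntegral F D)) (fine (D \ A))
      (𝓝 (dist (p.sum F + riemannIntegral F (D \ A)) (riemannIntegral F D))) :=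
    ((h.mono hD ht (hD.diff hA) sdiff_subset).tendsto.const_add _).dist tendsto_const_nhds
  have hle : dist (p.sum F + riemannIntegral F (D \ A)) (riemannIntegral F D) ≤ ε := by
    refine le_of_tendsto hlim ?_
    filter_upwards [eventually_mesh_le hδ] with q hq
    rw [← TaggedPartition.sum_union p q disjoint_sdiff_right (union_sdiff_cancel hAD)]
    exact (hdist _ (by rw [TaggedPartition.mesh_union]; exact sup_le hp hq)).le
  rw [h.riemannIntegral_diff hD ht hA hAD, dist_eq_norm] at hle
  rw [dist_eq_norm]
  convert hle using 2
  abel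

theorem RiemannIntegrable.riemannIntegral_biUnion_finset (h : RiemannIntegrable F D)
    (hD : MeasurableSet D) (ht : TotallyBounded D) {ι : Type*} {A : ι → Set X}
    (hA : ∀ i, MeasurableSet (A i)) (hd : Pairwise (Disjoint on A)) (hAD : ∀ i, A i ⊆ D)
    (s : Finset ι) :
    riemannIntegral F (⋃ i ∈ s, A i) = ∑ i ∈ s, riemannIntegral F (A i) := by
  classical
  induction s using Finset.induction_on with
  | empty => simp [riemannIntegral_empty]
  | insert i s hi ih =>
    have hs : MeasurableSet (⋃ j ∈ s, A j) := s.measurableSet_biUnion fun j _ => hA j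
    have hsD : (⋃ j ∈ s, A j) ⊆ D := iUnion₂_subset fun j _ => hAD j
    have := neBot_fine (hA i) (ht.subset (hAD i))
    have := neBot_fine hs (ht.subset hsD)
    have hdisj : Disjoint (A i) (⋃ j ∈ s, A j) :=
      disjoint_iUnion₂_right.2 fun j hj => hd (ne_of_mem_of_not_mem hj hi).symm
    rw [Finset.set_biUnion_insert, Finset.sum_insert hi, ← ih,
      (h.mono hD ht (hA i) (hAD i)).riemannIntegral_union (h.mono hD ht hs hsD)
      (h.mono hD ht ((hA i).union hs) (union_subset (hAD i) hsD)) hdisj]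

end Complete

end RiemannIntegral

section VectorMeasureKernel

variable {X V : Type*} [MeasurableSpace X]

theorem tendsto_vectorMeasure_inter_biUnion [AddCommGroup V] [TopologicalSpace V]
    [T2Space V] (m : VectorMeasure X V)
    {A : ℕ → Set X} (hA : ∀ i, MeasurableSet (A i)) (hd : Pairwise (Disjoint on A))
    {C : Set X} (hC : MeasurableSet C) (hCA : C ⊆ ⋃ i, A i) :
    Tendsto (fun s : Finset ℕ => m (C ∩ ⋃ i ∈ s, A i)) atTop (𝓝 (m C)) := by
  have hCi : ∀ i, MeasurableSet (C ∩ A i) := fun i => hC.inter (hA i)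
  have hdi : Pairwise (Disjoint on fun i => C ∩ A i) := fun i j hij =>
    (hd hij).mono inter_subset_right inter_subset_right
  have h := m.hasSum_of_disjoint_iUnion hCi hdi
  rw [← inter_iUnion, inter_eq_left.2 hCA] at h
  refine Tendsto.congr (fun s => ?_) h
  rw [inter_iUnion₂, m.of_biUnion_finset (fun i _ j _ hij => hdi hij) fun i _ => hCi i]

variable [PseudoEMetricSpace X] [OpensMeasurableSpace X] [NormedAddCommGroup V] [CompleteSpace V]
  {D : Set X} {F : X → VectorMeasure X V}

/-- A fine partition whose tags all lie in `⋃ i ∈ s, A i` restricts to a fine partition of this set,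
and the Riemann sum changes little because it involves finitely many σ-additive functions. -/
theorem RiemannIntegrable.hasSum_riemannIntegral
    (h : RiemannIntegrable (fun x => F x) D) (hD : MeasurableSet D) (ht : TotallyBounded D)
    {A : ℕ → Set X} (hA : ∀ i, MeasurableSet (A i)) (hd : Pairwise (Disjoint on A))
    (hAD : (⋃ i, A i) ⊆ D) :
    HasSum (fun i => riemannIntegral (fun x => F x) (A i))
      (riemannIntegral (fun x => F x) (⋃ i, A i)) := by
  have hU : MeasurableSet (⋃ i, A i) := .iUnion hA
  have hs (s : Finset ℕ) : MeasurableSet (⋃ i ∈ s, A i) := s.measurableSet_biUnion fun i _ => hA i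
  have hsU (s : Finset ℕ) : (⋃ i ∈ s, A i) ⊆ ⋃ i, A i :=
    iUnion₂_subset fun i _ => subset_iUnion A i
  refine Tendsto.congr (fun s => h.riemannIntegral_biUnion_finset hD ht hA hd
    (fun i => (subset_iUnion A i).trans hAD) s) (Metric.tendsto_nhds.2 fun ε hε => ?_)
  obtain ⟨δ, hδ, happrox⟩ := h.exists_mesh_forall_dist_le hD ht (by positivity : 0 < ε / 4)
  obtain ⟨p, hp⟩ := exists_taggedPartition_mesh_le hU (ht.subset hAD) hδ
  have htags : ∀ᶠ s : Finset ℕ in atTop, ∀ j, p.tag j ∈ ⋃ i ∈ s, A i := by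
    refine eventually_all.2 fun j => ?_
    obtain ⟨i, hi⟩ := mem_iUnion.1 (p.tag_mem_set j)
    filter_upwards [eventually_ge_atTop {i}] with s his
    exact mem_biUnion (his (Finset.mem_singleton_self i)) hi
  have hrestrict : Tendsto (fun s : Finset ℕ => ∑ j, F (p.tag j) (p.cell j ∩ ⋃ i ∈ s, A i)) atTop
      (𝓝 (p.sum fun x => F x)) :=
    tendsto_finsetSum _ fun j _ => tendsto_vectorMeasure_inter_biUnion _ hA hd
      (p.measurableSet_cell j) (p.cell_subset j)
  filter_upwards [htags, Metric.tendsto_nhds.1 hrestrict (ε / 4) (by positivity)] with s hst hsp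
  calc dist (riemannIntegral (fun x => F x) (⋃ i ∈ s, A i))
        (riemannIntegral (fun x => F x) (⋃ i, A i))
      ≤ dist (riemannIntegral (fun x => F x) (⋃ i ∈ s, A i))
          ((p.restrict (hs s) (hsU s) hst).sum fun x => F x)
        + dist ((p.restrict (hs s) (hsU s) hst).sum fun x => F x) (p.sum fun x => F x)
        + dist (p.sum fun x => F x) (riemannIntegral (fun x => F x) (⋃ i, A i)) :=
      dist_triangle4 _ _ _ _
    _ ≤ ε / 4 + ε / 4 + ε / 4 := by
      gcongr
      · rw [dist_comm]
        exact happrox _ (hs s) ((hsU s).trans hAD) _ ((p.mesh_restrict_le _ _ _).trans hp)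
      · exact hsp.le
      · exact happrox _ hU hAD p hp
    _ < ε := by linarith

end VectorMeasureKernel

section SignedMeasureKernel

variable {X : Type*} [MeasurableSpace X] {γ : SignedMeasure X} {A : Set X} {c : X → ℝ}

instance (γ : SignedMeasure X) : IsFiniteMeasure γ.variation := by
  rw [← SignedMeasure.totalVariation_eq_variation]
  infer_instance

theorem norm_mul_sub_setIntegral_le {I : Set X} (hc : γ.IntegrableOn c I) {x : X} {η : ℝ}
    (hη : 0 ≤ η) (h : ∀ y ∈ I, |c x - c y| ≤ η) :
    ‖c x * γ I - ∫ᵛ y in I, c y ∂•γ‖ ≤ η * γ.variation.real I := by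
  have hsub : c x * γ I - ∫ᵛ y in I, c y ∂•γ = ∫ᵛ y in I, (c x - c y) ∂•γ := by
    rw [VectorMeasure.integral_fun_sub (integrable_const _) hc, VectorMeasure.setIntegral_const]
    simp
  rw [hsub]
  refine (VectorMeasure.norm_setIntegral_le_of_norm_le_const h).trans ?_
  gcongr
  exact mul_le_of_le_one_right hη (ContinuousLinearMap.opNorm_lsmul_le (𝕜 := ℝ))

theorem TaggedPartition.norm_sum_sub_setIntegral_le (p : TaggedPartition A)
    (hc : γ.IntegrableOn c A) (hA : MeasurableSet A) {η : ℝ} (hη : 0 ≤ η)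
    (h : ∀ j, ∀ y ∈ p.cell j, |c (p.tag j) - c y| ≤ η) :
    ‖(p.sum fun x I => c x * γ I) - ∫ᵛ y in A, c y ∂•γ‖ ≤ η * γ.variation.real A := by
  have hcell : ∀ j, γ.IntegrableOn c (p.cell j) := fun j => hc.mono hA (p.cell_subset j)
  have hvar := measureReal_iUnion_fintype (μ := γ.variation) p.disjoint_cell p.measurableSet_cell
  have hint := VectorMeasure.setIntegral_iUnion_fintype (B := .lsmul ℝ ℝ) p.measurableSet_cell
    p.disjoint_cell hcell
  rw [p.iUnion_cell] at hvar hint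
  rw [hint, hvar, Finset.mul_sum, TaggedPartition.sum, ← Finset.sum_sub_distrib]
  exact (norm_sum_le _ _).trans (Finset.sum_le_sum fun j _ =>
    norm_mul_sub_setIntegral_le (hcell j) hη (h j))

theorem integrableOn_signedMeasure_of_continuousOn [TopologicalSpace X] [OpensMeasurableSpace X]
    {K : Set X} (hK : IsCompact K) (hc : ContinuousOn c K) (hA : MeasurableSet A) (hAK : A ⊆ K) :
    γ.IntegrableOn c A := by
  rw [VectorMeasure.IntegrableOn, VectorMeasure.Integrable, VectorMeasure.variation_restrict hA]
  exact hc.integrableOn_of_subset_isCompact hK hA hAK (measure_ne_top _ _)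

theorem tendsto_sum_mul_signedMeasure [PseudoEMetricSpace X] [OpensMeasurableSpace X] {K : Set X}
    (hK : IsCompact K) (hc : ContinuousOn c K) (hA : MeasurableSet A) (hAK : A ⊆ K) :
    Tendsto (fun p : TaggedPartition A => p.sum fun x I => c x * γ I) (fine A)
      (𝓝 (∫ᵛ x in A, c x ∂•γ)) := by
  refine Metric.tendsto_nhds.2 fun ε hε => ?_
  set v := γ.variation.real A
  have : 0 ≤ v := measureReal_nonneg
  have hη : 0 < ε / (v + 1) := by positivity
  obtain ⟨δ, hδ, h⟩ := EMetric.uniformContinuousOn_iff.1 (hK.uniformContinuousOn_of_continuous hc)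
    _ (ENNReal.ofReal_pos.2 hη)
  obtain ⟨t, ht0, htδ⟩ := exists_between hδ
  filter_upwards [eventually_mesh_le ht0] with p hp
  have hclose : ∀ j, ∀ y ∈ p.cell j, |c (p.tag j) - c y| ≤ ε / (v + 1) := fun j y hy => by
    have hlt := h (hAK (p.tag_mem_set j)) (hAK (p.cell_subset j hy))
      (((p.edist_tag_le hy).trans hp).trans_lt htδ)
    rw [edist_dist, ENNReal.ofReal_lt_ofReal_iff hη, Real.dist_eq] at hlt
    exact hlt.le
  rw [dist_eq_norm]
  refine (p.norm_sum_sub_setIntegral_le (integrableOn_signedMeasure_of_continuousOn hK hc hA hAK)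
    hA hη.le hclose).trans_lt ?_
  rw [div_mul_eq_mul_div, div_lt_iff₀ (by positivity)]
  linarith

end SignedMeasureKernel

section CovarianceDomination

variable {X : Type*} [MeasurableSpace X]

theorem sum_measureReal_prod_le_fst {Y ι : Type*} [MeasurableSpace Y] {ρ : Measure (X × Y)}
    [IsFiniteMeasure ρ] {A : Set X} {B : ι → Set Y} (hA : MeasurableSet A)
    (hB : ∀ i, MeasurableSet (B i)) (hd : Pairwise (Disjoint on B)) (s : Finset ι) :
    ∑ i ∈ s, ρ.real (A ×ˢ B i) ≤ ρ.fst.real A := by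
  rw [← measureReal_biUnion_finset (fun i _ j _ hij => (hd hij).set_prod_right _ _)
    fun i _ => hA.prod (hB i), Measure.fst, map_measureReal_apply measurable_fst hA]
  exact measureReal_mono (iUnion₂_subset fun i _ => prod_subset_preimage_fst A (B i))

theorem sum_measureReal_prod_le_snd {Y ι : Type*} [MeasurableSpace Y] {ρ : Measure (X × Y)}
    [IsFiniteMeasure ρ] {A : ι → Set X} {B : Set Y} (hA : ∀ i, MeasurableSet (A i))
    (hB : MeasurableSet B) (hd : Pairwise (Disjoint on A)) (s : Finset ι) :
    ∑ i ∈ s, ρ.real (A i ×ˢ B) ≤ ρ.snd.real B := by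
  rw [← measureReal_biUnion_finset (fun i _ j _ hij => (hd hij).set_prod_left _ _)
    fun i _ => (hA i).prod hB, Measure.snd, map_measureReal_apply measurable_snd hB]
  exact measureReal_mono (iUnion₂_subset fun i _ => prod_subset_preimage_snd (A i) B)

/-- The sum of the two marginals of the variation of a signed measure on `X × X`: if the measure
is the covariance of a vector measure, the integral of the latter is bounded in `L²` of this sum. -/
def marginalSum (γ : SignedMeasure (X × X)) : Measure X := γ.variation.fst + γ.variation.snd

instance (γ : SignedMeasure (X × X)) : IsFiniteMeasure (marginalSum γ) := by
  unfold marginalSum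
  infer_instance

theorem mul_mul_signedMeasure_le {γ : SignedMeasure X} (a b : ℝ) (S : Set X) :
    a * b * γ S ≤ a ^ 2 / 2 * γ.variation.real S + b ^ 2 / 2 * γ.variation.real S := by
  have hγ : |γ S| ≤ γ.variation.real S := by
    rw [← Real.norm_eq_abs]
    exact VectorMeasure.norm_measure_le_variation (measure_ne_top _ _)
  have hab : |a * b| ≤ a ^ 2 / 2 + b ^ 2 / 2 := by
    rw [abs_le]
    constructor <;> nlinarith [sq_nonneg (a - b), sq_nonneg (a + b)]
  calc a * b * γ S ≤ |a * b| * |γ S| := by rw [← abs_mul]; exact le_abs_self _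
    _ ≤ (a ^ 2 / 2 + b ^ 2 / 2) * γ.variation.real S := by gcongr
    _ = _ := add_mul _ _ _

variable {H : Type*} [NormedAddCommGroup H] [InnerProductSpace ℝ H] {m : VectorMeasure X H}
  {γ : SignedMeasure (X × X)}

theorem norm_sum_smul_sq_le
    (hγ : ∀ A B, MeasurableSet A → MeasurableSet B → γ (A ×ˢ B) = inner ℝ (m A) (m B))
    {ι : Type*} (s : Finset ι) (c : ι → ℝ) {A : ι → Set X} (hA : ∀ i, MeasurableSet (A i))
    (hd : Pairwise (Disjoint on A)) :
    ‖∑ i ∈ s, c i • m (A i)‖ ^ 2 ≤ ∑ i ∈ s, (marginalSum γ).real (A i) * c i ^ 2 := by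
  calc ‖∑ i ∈ s, c i • m (A i)‖ ^ 2 = ∑ i ∈ s, ∑ j ∈ s, c i * c j * γ (A i ×ˢ A j) := by
        simp only [← real_inner_self_eq_norm_sq, sum_inner, inner_sum, real_inner_smul_left,
          real_inner_smul_right, hγ _ _ (hA _) (hA _), mul_assoc]
        exact Finset.sum_congr rfl fun i _ => Finset.sum_congr rfl fun j _ => by
          rw [real_inner_comm]
    _ ≤ ∑ i ∈ s, ∑ j ∈ s, (c i ^ 2 / 2 * γ.variation.real (A i ×ˢ A j)
          + c j ^ 2 / 2 * γ.variation.real (A i ×ˢ A j)) :=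
        Finset.sum_le_sum fun i _ => Finset.sum_le_sum fun j _ => mul_mul_signedMeasure_le _ _ _
    _ = ∑ i ∈ s, c i ^ 2 / 2 * ∑ j ∈ s, γ.variation.real (A i ×ˢ A j)
          + ∑ j ∈ s, c j ^ 2 / 2 * ∑ i ∈ s, γ.variation.real (A i ×ˢ A j) := by
        simp only [Finset.sum_add_distrib, Finset.mul_sum]
        congr 1
        exact Finset.sum_comm
    _ ≤ ∑ i ∈ s, c i ^ 2 / 2 * γ.variation.fst.real (A i)
          + ∑ j ∈ s, c j ^ 2 / 2 * γ.variation.snd.real (A j) := by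
        gcongr with i _ j
        · exact sum_measureReal_prod_le_fst (hA i) hA hd s
        · exact sum_measureReal_prod_le_snd hA (hA j) hd s
    _ ≤ ∑ i ∈ s, (marginalSum γ).real (A i) * c i ^ 2 := by
        rw [← Finset.sum_add_distrib]
        refine Finset.sum_le_sum fun i _ => ?_
        rw [marginalSum, measureReal_add_apply]
        nlinarith [sq_nonneg (c i), measureReal_nonneg (μ := γ.variation.fst) (s := A i),
          measureReal_nonneg (μ := γ.variation.snd) (s := A i)]

/-- The integral of simple functions against a vector measure. -/
def simpleFuncIntegral (m : VectorMeasure X H) : SimpleFunc X ℝ →ₗ[ℝ] H :=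
  let T : Set X → ℝ →L[ℝ] H := fun A => .toSpanSingleton ℝ (m A)
  have hT : FinMeasAdditive 0 T := fun A B hA hB _ _ hAB => by
    ext
    simp [T, m.of_union hAB hA hB]
  { toFun := fun f => f.setToSimpleFunc T
    map_add' := fun _ _ => SimpleFunc.setToSimpleFunc_add T hT integrable_zero_measure
      integrable_zero_measure
    map_smul' := fun c _ => SimpleFunc.setToSimpleFunc_smul_real T hT c integrable_zero_measure }

theorem simpleFuncIntegral_apply (m : VectorMeasure X H) (f : SimpleFunc X ℝ) :
    simpleFuncIntegral m f = ∑ c ∈ f.range, c • m (f ⁻¹' {c}) := rfl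

theorem simpleFuncIntegral_indicator (m : VectorMeasure X H) {A : Set X} (hA : MeasurableSet A) :
    simpleFuncIntegral m ((SimpleFunc.const X 1).piecewise A hA (.const X 0)) = m A := by
  have h := SimpleFunc.setToSimpleFunc_indicator
    (fun A => ContinuousLinearMap.toSpanSingleton ℝ (m A)) (by ext; simp) hA (1 : ℝ)
  exact h.trans (by simp)

/-- The inclusion of the simple functions in `L²` of a finite measure. -/
def simpleFuncToL2 (ν : Measure X) [IsFiniteMeasure ν] : SimpleFunc X ℝ →ₗ[ℝ] Lp ℝ 2 ν where
  toFun f := (f.memLp_of_isFiniteMeasure 2 ν).toLp f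
  map_add' _ _ := rfl
  map_smul' _ _ := rfl

variable {ν : Measure X} [IsFiniteMeasure ν]

theorem simpleFuncToL2_apply (f : SimpleFunc X ℝ) :
    simpleFuncToL2 ν f = (f.memLp_of_isFiniteMeasure 2 ν).toLp f := rfl

theorem denseRange_simpleFuncToL2 : DenseRange (simpleFuncToL2 ν) := by
  refine (Lp.simpleFunc.dense (E := ℝ) (μ := ν) (p := 2) (by norm_num)).mono fun f hf => ?_
  refine ⟨Lp.simpleFunc.toSimpleFunc ⟨f, hf⟩, ?_⟩
  exact congrArg Subtype.val (Lp.simpleFunc.toLp_toSimpleFunc ⟨f, hf⟩)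

theorem simpleFuncToL2_indicator {A : Set X} (hA : MeasurableSet A) :
    simpleFuncToL2 ν ((SimpleFunc.const X 1).piecewise A hA (.const X 0)) =
      indicatorConstLp 2 hA (measure_ne_top ν A) 1 := by
  rw [simpleFuncToL2_apply, indicatorConstLp]
  congr 1

theorem norm_simpleFuncToL2_sq (f : SimpleFunc X ℝ) :
    ‖simpleFuncToL2 ν f‖ ^ 2 = ∑ c ∈ f.range, ν.real (f ⁻¹' {c}) * c ^ 2 := by
  have hf := f.memLp_of_isFiniteMeasure 2 ν
  calc ‖simpleFuncToL2 ν f‖ ^ 2 = ∫ x, f.map (· ^ 2) x ∂ν := by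
        rw [← real_inner_self_eq_norm_sq, L2.inner_def, simpleFuncToL2_apply]
        refine integral_congr_ae ?_
        filter_upwards [hf.coeFn_toLp] with x hx
        simp [hx, sq]
    _ = ∑ c ∈ f.range, ν.real (f ⁻¹' {c}) * c ^ 2 := by
        rw [← SimpleFunc.integral_eq_integral _ (SimpleFunc.integrable_of_isFiniteMeasure _),
          SimpleFunc.map_integral f (· ^ 2) f.integrable_of_isFiniteMeasure (by simp)]
        simp

/-- The integral with respect to `m` extends to a bounded operator on `L²(marginalSum γ)`, whose
adjoint yields the densities. -/
theorem exists_density_of_inner_eq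
    (hγ : ∀ A B, MeasurableSet A → MeasurableSet B → γ (A ×ˢ B) = inner ℝ (m A) (m B)) :
    ∃ r : H →L[ℝ] Lp ℝ 2 (marginalSum γ), ∀ h A, MeasurableSet A →
      ∫ x in A, r h x ∂(marginalSum γ) = inner ℝ h (m A) := by
  set ν := marginalSum γ
  let J : H →ₗᵢ[ℝ] UniformSpace.Completion H := UniformSpace.Completion.toComplₗᵢ
  let T := J.toLinearMap ∘ₗ simpleFuncIntegral m
  have hbound : ∀ f, ‖T f‖ ≤ 1 * ‖simpleFuncToL2 ν f‖ := fun f => by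
    rw [LinearMap.comp_apply, LinearIsometry.coe_toLinearMap, J.norm_map, one_mul,
      ← sq_le_sq₀ (norm_nonneg _) (norm_nonneg _), norm_simpleFuncToL2_sq, simpleFuncIntegral_apply]
    exact norm_sum_smul_sq_le hγ _ _ f.measurableSet_fiber
      fun a b hab => (disjoint_singleton.2 hab).preimage f
  let L := T.extendOfNorm (simpleFuncToL2 ν)
  have hL : ∀ A (hA : MeasurableSet A),
      L (indicatorConstLp 2 hA (measure_ne_top ν A) 1) = J (m A) := fun A hA => by
    rw [← simpleFuncToL2_indicator, ← simpleFuncIntegral_indicator m hA]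
    exact LinearMap.extendOfNorm_eq denseRange_simpleFuncToL2 ⟨1, hbound⟩ _
  refine ⟨ContinuousLinearMap.adjoint L ∘L J.toContinuousLinearMap, fun h A hA => ?_⟩
  rw [← J.inner_map_map, ← hL A hA, ← ContinuousLinearMap.adjoint_inner_left, real_inner_comm,
    L2.inner_indicatorConstLp_one]
  rfl

end CovarianceDomination

section TensorKernel

theorem inner_Lp_eq_integral_mul {X : Type*} [MeasurableSpace X] {μ : Measure X}
    (f g : Lp ℝ 2 μ) : inner ℝ f g = ∫ x, f x * g x ∂μ := by
  simp only [L2.inner_def, RCLike.inner_apply, conj_trivial, mul_comm]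

variable {X Y : Type*} [MeasurableSpace X] [MeasurableSpace Y] {ν : Measure X} {ρ : Measure Y}

theorem memLp_mul_prod (f : Lp ℝ 2 ν) (g : Lp ℝ 2 ρ) :
    MemLp (fun w : X × Y => f w.1 * g w.2) 2 (ν.prod ρ) := by
  have hmeas : AEStronglyMeasurable (fun w : X × Y => f w.1 * g w.2) (ν.prod ρ) :=
    (Lp.aestronglyMeasurable f).comp_fst.mul (Lp.aestronglyMeasurable g).comp_snd
  refine (memLp_two_iff_integrable_sq hmeas).2 ?_
  simp only [mul_pow]
  exact (Lp.memLp f).integrable_sq.mul_prod (Lp.memLp g).integrable_sq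

/-- The tensor product `f ⊗ g` of two square integrable functions. -/
def tensorL2 (f : Lp ℝ 2 ν) (g : Lp ℝ 2 ρ) : Lp ℝ 2 (ν.prod ρ) :=
  (memLp_mul_prod f g).toLp _

theorem coeFn_tensorL2 (f : Lp ℝ 2 ν) (g : Lp ℝ 2 ρ) :
    tensorL2 f g =ᵐ[ν.prod ρ] fun w => f w.1 * g w.2 :=
  (memLp_mul_prod f g).coeFn_toLp

theorem inner_tensorL2 [SFinite ν] [SFinite ρ] (f f' : Lp ℝ 2 ν) (g g' : Lp ℝ 2 ρ) :
    inner ℝ (tensorL2 f g) (tensorL2 f' g') = inner ℝ f f' * inner ℝ g g' := by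
  simp only [inner_Lp_eq_integral_mul]
  rw [← integral_prod_mul]
  refine integral_congr_ae ?_
  filter_upwards [coeFn_tensorL2 f g, coeFn_tensorL2 f' g'] with w h h'
  rw [h, h']
  ring

/-- The isometry of `L²(ν ⊗ ν)` that swaps the two variables. -/
def swapL2 (ν : Measure X) [SFinite ν] : Lp ℝ 2 (ν.prod ν) →ₗᵢ[ℝ] Lp ℝ 2 (ν.prod ν) :=
  Lp.compMeasurePreservingₗᵢ ℝ Prod.swap Measure.measurePreserving_swap

theorem coeFn_swapL2 [SFinite ν] (f : Lp ℝ 2 (ν.prod ν)) :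
    swapL2 ν f =ᵐ[ν.prod ν] fun w => f w.swap :=
  Lp.coeFn_compMeasurePreserving f Measure.measurePreserving_swap

theorem swapL2_tensorL2 [SFinite ν] (f g : Lp ℝ 2 ν) :
    swapL2 ν (tensorL2 f g) = tensorL2 g f := by
  refine Lp.ext ?_
  filter_upwards [coeFn_swapL2 (tensorL2 f g), coeFn_tensorL2 g f,
    Measure.measurePreserving_swap.quasiMeasurePreserving.ae (coeFn_tensorL2 f g)] with w h h' h''
  rw [h, h', h'', mul_comm]
  rfl

variable [IsFiniteMeasure ν]

open Classical in
/-- The indicator of a measurable set as an element of `L²` (and `0` for other sets). -/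
def indicatorL2 (ν : Measure X) [IsFiniteMeasure ν] (A : Set X) : Lp ℝ 2 ν :=
  if hA : MeasurableSet A then indicatorConstLp 2 hA (measure_ne_top ν A) 1 else 0

theorem indicatorL2_of_measurableSet {A : Set X} (hA : MeasurableSet A) :
    indicatorL2 ν A = indicatorConstLp 2 hA (measure_ne_top ν A) 1 := dif_pos hA

theorem inner_indicatorL2 {A : Set X} (hA : MeasurableSet A) (f : Lp ℝ 2 ν) :
    inner ℝ (indicatorL2 ν A) f = ∫ x in A, f x ∂ν := by
  rw [indicatorL2_of_measurableSet hA, L2.inner_indicatorConstLp_one]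

theorem inner_indicatorL2_indicatorL2 {A B : Set X} (hA : MeasurableSet A)
    (hB : MeasurableSet B) :
    inner ℝ (indicatorL2 ν A) (indicatorL2 ν B) = ν.real (A ∩ B) := by
  rw [indicatorL2_of_measurableSet hA, indicatorL2_of_measurableSet hB,
    L2.real_inner_indicatorConstLp_one_indicatorConstLp_one]

theorem tensorL2_indicatorL2_ae_eq_zero {A : Set X} (hA : MeasurableSet A)
    {S : Set (X × Y)} (hS : MeasurableSet S) (hAS : ∀ w ∈ S, w.1 ∉ A) (g : Lp ℝ 2 ρ) :
    tensorL2 (indicatorL2 ν A) g =ᵐ[(ν.prod ρ).restrict S] 0 := by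
  rw [indicatorL2_of_measurableSet hA]
  filter_upwards [ae_restrict_mem hS, ae_restrict_of_ae (coeFn_tensorL2 _ g),
    ae_restrict_of_ae (Measure.quasiMeasurePreserving_fst.ae
      (indicatorConstLp_coeFn (p := 2) (hs := hA) (hμs := measure_ne_top ν A) (c := (1 : ℝ))))]
    with w hw h h'
  rw [h, h', indicator_of_notMem (hAS w hw), zero_mul, Pi.zero_apply]

end TensorKernel

section Hilbert

variable {X H : Type*} [MeasurableSpace X] [PseudoEMetricSpace X] [NormedAddCommGroup H]
  [InnerProductSpace ℝ H] [CompleteSpace H]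

theorem exists_tendsto_of_tendsto_inner {α : Type*} {l : Filter α} [l.NeBot] {S : α → H} {c : ℝ}
    (h : Tendsto (fun p : α × α => inner ℝ (S p.1) (S p.2)) (l ×ˢ l) (𝓝 c)) :
    ∃ a, Tendsto S l (𝓝 a) := by
  refine cauchy_map_iff_exists_tendsto.1 (cauchy_map_iff.2 ⟨inferInstance, ?_⟩)
  rw [uniformity_eq_comap_nhds_zero, tendsto_comap_iff, tendsto_zero_iff_norm_tendsto_zero]
  have hdiag : Tendsto (fun p : α => inner ℝ (S p) (S p)) l (𝓝 c) :=
    h.comp (tendsto_id.prodMk tendsto_id)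
  have hsq : Tendsto (fun p : α × α => ‖S p.2 - S p.1‖ ^ 2) (l ×ˢ l) (𝓝 0) := by
    have hlim := ((hdiag.comp tendsto_snd).sub (h.const_mul 2)).add (hdiag.comp tendsto_fst)
    refine (hlim.congr fun p => ?_).trans (by ring_nf; exact le_rfl)
    simp only [Function.comp_apply]
    rw [norm_sub_sq_real, real_inner_self_eq_norm_sq, real_inner_self_eq_norm_sq,
      real_inner_comm]
  simpa [Function.comp_def] using hsq.sqrt

theorem riemannIntegrable_of_tendsto_inner {F : X → Set X → H} {A : Set X} [(fine A).NeBot]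
    {c : ℝ} (h : Tendsto (fun pq : TaggedPartition A × TaggedPartition A =>
      pq.1.sum fun x I => pq.2.sum fun y J => inner ℝ (F x I) (F y J)) (fine A ×ˢ fine A) (𝓝 c)) :
    RiemannIntegrable F A := by
  refine exists_tendsto_of_tendsto_inner (h.congr fun pq => ?_)
  simp only [TaggedPartition.sum, sum_inner, inner_sum]
  exact Finset.sum_comm

theorem RiemannIntegrable.riemannIntegral_ae_eq_zero {Y : Type*} [MeasurableSpace Y]
    {μ : Measure Y} {F : X → Set X → Lp ℝ 2 μ} {A : Set X}
    [(fine A).NeBot] (h : RiemannIntegrable F A)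
    {S : Set Y} (hF : ∀ x I, MeasurableSet I → I ⊆ A → F x I =ᵐ[μ.restrict S] 0) :
    ⇑(riemannIntegral F A) =ᵐ[μ.restrict S] 0 := by
  let L := LpToLpRestrictCLM Y ℝ ℝ μ 2 S
  have hL : ∀ f, L f = 0 ↔ f =ᵐ[μ.restrict S] 0 := fun f => by
    have hf := LpToLpRestrictCLM_coeFn (F := ℝ) ℝ S f
    rw [Lp.eq_zero_iff_ae_eq_zero]
    exact ⟨hf.symm.trans, hf.trans⟩
  refine (hL _).1 (tendsto_nhds_unique (h.tendsto_map L) (tendsto_const_nhds.congr fun p => ?_))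
  exact (Finset.sum_eq_zero fun j _ =>
    (hL _).2 (hF _ _ (p.measurableSet_cell j) (p.cell_subset j))).symm

end Hilbert

section DoubleSums

variable {X : Type*} [MeasurableSpace X] [PseudoEMetricSpace X] [OpensMeasurableSpace X]
  [SecondCountableTopology X] {A B D K : Set X}

theorem tendsto_sum_sum_mul_signedMeasure {γ : SignedMeasure (X × X)} {c : X × X → ℝ}
    (hK : IsCompact K) (hc : ContinuousOn c (K ×ˢ K)) (hA : MeasurableSet A) (hAK : A ⊆ K)
    (hB : MeasurableSet B) (hBK : B ⊆ K) :
    Tendsto (fun pq : TaggedPartition A × TaggedPartition B =>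
      pq.1.sum fun x I => pq.2.sum fun y J => c (x, y) * γ (I ×ˢ J)) (fine A ×ˢ fine B)
      (𝓝 (∫ᵛ w in A ×ˢ B, c w ∂•γ)) :=
  ((tendsto_sum_mul_signedMeasure (hK.prod hK) hc (hA.prod hB) (prod_mono hAK hBK)).comp
    tendsto_prod).congr fun pq => pq.1.sum_prod pq.2 fun w E => c w * γ E

variable {ν : Measure X} [IsFiniteMeasure ν] {g : X → Lp ℝ 2 ν}

/-- The double sums of the covariances `ν (I ∩ J) ⟪g x, g y⟫` are Riemann sums for the image of `ν`
on the diagonal. -/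
theorem riemannIntegrable_tensorL2 (hK : IsCompact K) (hg : ContinuousOn g K)
    (hD : MeasurableSet D) (hDK : D ⊆ K) :
    RiemannIntegrable (fun x I => tensorL2 (indicatorL2 ν I) (g x)) D := by
  have := neBot_fine hD (hK.totallyBounded.subset hDK)
  have hdiag : Measurable fun x : X => (x, x) := measurable_id.prodMk measurable_id
  have hc : ContinuousOn (fun w : X × X => inner ℝ (g w.1) (g w.2)) (K ×ˢ K) :=
    (hg.comp continuousOn_fst fun _ hw => hw.1).inner (hg.comp continuousOn_snd fun _ hw => hw.2)
  refine riemannIntegrable_of_tendsto_inner ((tendsto_sum_sum_mul_signedMeasure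
    (γ := (ν.map fun x => (x, x)).toSignedMeasure) hK hc hD hDK hD hDK).congr fun pq => ?_)
  refine pq.1.sum_congr fun x I hI _ _ => pq.2.sum_congr fun y J hJ _ _ => ?_
  rw [inner_tensorL2, inner_indicatorL2_indicatorL2 hI hJ,
    Measure.toSignedMeasure_apply_measurable (hI.prod hJ),
    map_measureReal_apply hdiag (hI.prod hJ), mul_comm]
  rfl

theorem riemannIntegral_tensorL2_ae_eq (hK : IsCompact K) (hg : ContinuousOn g K)
    (hD : MeasurableSet D) (hDK : D ⊆ K) (hA : MeasurableSet A) (hAD : A ⊆ D) :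
    ⇑(riemannIntegral (fun x I => tensorL2 (indicatorL2 ν I) (g x)) A) =ᵐ[ν.prod ν]
      (Prod.fst ⁻¹' A).indicator
        ⇑(riemannIntegral (fun x I => tensorL2 (indicatorL2 ν I) (g x)) D) := by
  set F : X → Set X → Lp ℝ 2 (ν.prod ν) := fun x I => tensorL2 (indicatorL2 ν I) (g x)
  have ht : TotallyBounded D := hK.totallyBounded.subset hDK
  have hF : RiemannIntegrable F D := riemannIntegrable_tensorL2 hK hg hD hDK
  have := neBot_fine hA (ht.subset hAD)
  have := neBot_fine (hD.diff hA) (ht.subset sdiff_subset)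
  have hSA : MeasurableSet (Prod.fst ⁻¹' A : Set (X × X)) := measurable_fst hA
  have hout : ⇑(riemannIntegral F A) =ᵐ[(ν.prod ν).restrict (Prod.fst ⁻¹' A)ᶜ] 0 :=
    (hF.mono hD ht hA hAD).riemannIntegral_ae_eq_zero fun x I hI hIA =>
      tensorL2_indicatorL2_ae_eq_zero hI hSA.compl (fun w hw hwI => hw (hIA hwI)) _
  have hin : ⇑(riemannIntegral F (D \ A)) =ᵐ[(ν.prod ν).restrict (Prod.fst ⁻¹' A)] 0 :=
    (hF.mono hD ht (hD.diff hA) sdiff_subset).riemannIntegral_ae_eq_zero fun x I hI hIA =>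
      tensorL2_indicatorL2_ae_eq_zero hI hSA (fun w hw hwI => (hIA hwI).2 hw) _
  rw [hF.riemannIntegral_diff hD ht hA hAD] at hin
  filter_upwards [(ae_restrict_iff' hSA.compl).1 hout, (ae_restrict_iff' hSA).1 hin,
    Lp.coeFn_sub (riemannIntegral F D) (riemannIntegral F A)] with w hout hin hsub
  by_cases hw : w ∈ Prod.fst ⁻¹' A
  · rw [indicator_of_mem hw]
    have := hin hw
    rw [hsub, Pi.sub_apply, Pi.zero_apply, sub_eq_zero] at this
    exact this.symm
  · rw [indicator_of_notMem hw]
    exact hout hw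

theorem inner_riemannIntegral_tensorL2_swapL2 (hK : IsCompact K) (hg : ContinuousOn g K)
    (hD : MeasurableSet D) (hDK : D ⊆ K) (hA : MeasurableSet A) (hAD : A ⊆ D)
    (hB : MeasurableSet B) (hBD : B ⊆ D) {k : Lp ℝ 2 (ν.prod ν)}
    (hk : riemannIntegral (fun x I => tensorL2 (indicatorL2 ν I) (g x)) D = k) :
    inner ℝ (riemannIntegral (fun x I => tensorL2 (indicatorL2 ν I) (g x)) A)
      (swapL2 ν (riemannIntegral (fun x I => tensorL2 (indicatorL2 ν I) (g x)) B)) =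
      ∫ w in A ×ˢ B, k w * swapL2 ν k w ∂(ν.prod ν) := by
  rw [inner_Lp_eq_integral_mul, ← integral_indicator (hA.prod hB)]
  refine integral_congr_ae ?_
  filter_upwards [riemannIntegral_tensorL2_ae_eq hK hg hD hDK hA hAD, coeFn_swapL2 k,
    coeFn_swapL2 (riemannIntegral (fun x I => tensorL2 (indicatorL2 ν I) (g x)) B),
    Measure.measurePreserving_swap.quasiMeasurePreserving.ae
      (riemannIntegral_tensorL2_ae_eq hK hg hD hDK hB hBD)] with w hwA hwk hwB hwB'
  rw [hwA, hwB, hwB', hk]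
  by_cases hw₁ : w.1 ∈ A <;> by_cases hw₂ : w.2 ∈ B <;> simp [hw₁, hw₂, hwk]

theorem exists_signedMeasure_tendsto_sum_setIntegral_mul_setIntegral (hK : IsCompact K)
    (hg : ContinuousOn g K) (hD : MeasurableSet D) (hDK : D ⊆ K) :
    ∃ Q : SignedMeasure (X × X), ∀ A B, MeasurableSet A → A ⊆ D → MeasurableSet B → B ⊆ D →
      Tendsto (fun pq : TaggedPartition A × TaggedPartition B => pq.1.sum fun x I =>
        pq.2.sum fun y J => (∫ u in I, g y u ∂ν) * ∫ v in J, g x v ∂ν) (fine A ×ˢ fine B)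
        (𝓝 (Q (A ×ˢ B))) := by
  set F : X → Set X → Lp ℝ 2 (ν.prod ν) := fun x I => tensorL2 (indicatorL2 ν I) (g x) with hFdef
  have ht : TotallyBounded D := hK.totallyBounded.subset hDK
  have hF : RiemannIntegrable F D := riemannIntegrable_tensorL2 hK hg hD hDK
  set k := riemannIntegral F D with hk
  have hkk : Integrable (fun w => k w * swapL2 ν k w) (ν.prod ν) :=
    (Lp.memLp k).integrable_mul (Lp.memLp (swapL2 ν k))
  refine ⟨(ν.prod ν).withDensityᵥ fun w => k w * swapL2 ν k w, fun A B hA hAD hB hBD => ?_⟩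
  have := neBot_fine hB (ht.subset hBD)
  have hFB := hF.mono hD ht hB hBD
  have hlim := (hF.mono hD ht hA hAD).tendsto_inner (hFB.map (swapL2 ν).toContinuousLinearMap)
  rw [hFB.riemannIntegral_map, LinearIsometry.coe_toContinuousLinearMap,
    inner_riemannIntegral_tensorL2_swapL2 hK hg hD hDK hA hAD hB hBD hk.symm] at hlim
  rw [withDensityᵥ_apply hkk (hA.prod hB)]
  refine hlim.congr fun pq => pq.1.sum_congr fun x I hI _ _ => pq.2.sum_congr fun y J hJ _ _ => ?_
  rw [hFdef, swapL2_tensorL2, inner_tensorL2, inner_indicatorL2 hI, real_inner_comm,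
    inner_indicatorL2 hJ]

theorem exists_signedMeasure_tendsto_sum_inner_mul_inner {H : Type*} [NormedAddCommGroup H]
    [InnerProductSpace ℝ H] {m : VectorMeasure X H} {γ : SignedMeasure (X × X)}
    (hγ : ∀ A B, MeasurableSet A → MeasurableSet B → γ (A ×ˢ B) = inner ℝ (m A) (m B))
    {z : X → H} (hK : IsCompact K) (hz : ContinuousOn z K) (hD : MeasurableSet D) (hDK : D ⊆ K) :
    ∃ Q : SignedMeasure (X × X), ∀ A B, MeasurableSet A → A ⊆ D → MeasurableSet B → B ⊆ D →
      Tendsto (fun pq : TaggedPartition A × TaggedPartition B => pq.1.sum fun x I =>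
        pq.2.sum fun y J => inner ℝ (z y) (m I) * inner ℝ (z x) (m J)) (fine A ×ˢ fine B)
        (𝓝 (Q (A ×ˢ B))) := by
  obtain ⟨r, hr⟩ := exists_density_of_inner_eq hγ
  obtain ⟨Q, hQ⟩ := exists_signedMeasure_tendsto_sum_setIntegral_mul_setIntegral hK
    (r.continuous.comp_continuousOn hz) hD hDK
  refine ⟨Q, fun A B hA hAD hB hBD => (hQ A B hA hAD hB hBD).congr fun pq =>
    pq.1.sum_congr fun x I hI _ _ => pq.2.sum_congr fun y J hJ _ _ => ?_⟩
  rw [Function.comp_apply, Function.comp_apply, hr _ I hI, hr _ J hJ]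

end DoubleSums

section GaussianProducts

variable {Ω : Type*} [MeasurableSpace Ω] {P : Measure Ω}

/-- The elements of `L²` that have a representative in the space `V` of functions. -/
def classesL2 (V : Submodule ℝ (Ω → ℝ)) (P : Measure Ω) : Submodule ℝ (Lp ℝ 2 P) where
  carrier := {f | ∃ a ∈ V, f =ᵐ[P] a}
  zero_mem' := ⟨0, V.zero_mem, Lp.coeFn_zero ℝ 2 P⟩
  add_mem' := by
    rintro f g ⟨a, ha, hfa⟩ ⟨b, hb, hgb⟩
    exact ⟨a + b, V.add_mem ha hb, (Lp.coeFn_add f g).trans (hfa.add hgb)⟩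
  smul_mem' := by
    rintro r f ⟨a, ha, hfa⟩
    exact ⟨r • a, V.smul_mem r ha, (Lp.coeFn_smul r f).trans (hfa.const_smul r)⟩

/-- A family of operators `g ↦ L f g` that multiplies inner products according to Isserlis' formula,
as the pointwise product of centred jointly Gaussian variables does. -/
def IsIsserlisProduct {G H : Type*} [NormedAddCommGroup G] [InnerProductSpace ℝ G]
    [NormedAddCommGroup H] [InnerProductSpace ℝ H] (L : G → G →L[ℝ] H) : Prop :=
  ∀ a b c d, inner ℝ (L a b) (L c d) =
    inner ℝ a b * inner ℝ c d + inner ℝ a c * inner ℝ b d + inner ℝ a d * inner ℝ b c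

namespace IsCentredGaussianSpace

variable {V : Submodule ℝ (Ω → ℝ)}

theorem memLp_mul_classesL2 (hV : IsCentredGaussianSpace V P) (f g : classesL2 V P) :
    MemLp (⇑(f : Lp ℝ 2 P) * ⇑(g : Lp ℝ 2 P)) 2 P := by
  obtain ⟨a, ha, hfa⟩ := f.2
  obtain ⟨b, hb, hgb⟩ := g.2
  exact (memLp_congr_ae (hfa.mul hgb)).2 (hV.memLp_mul ha hb)

theorem inner_toLp_mul (hV : IsCentredGaussianSpace V P) (f g f' g' : classesL2 V P) :
    inner ℝ (hV.memLp_mul_classesL2 f g).toLp (hV.memLp_mul_classesL2 f' g').toLp =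
      inner ℝ f g * inner ℝ f' g' + inner ℝ f f' * inner ℝ g g'
        + inner ℝ f g' * inner ℝ g f' := by
  obtain ⟨a, ha, hfa⟩ := f.2
  obtain ⟨b, hb, hgb⟩ := g.2
  obtain ⟨a', ha', hfa'⟩ := f'.2
  obtain ⟨b', hb', hgb'⟩ := g'.2
  have hinner {u v : Lp ℝ 2 P} {s t : Ω → ℝ} (hu : u =ᵐ[P] s) (hv : v =ᵐ[P] t) :
      inner ℝ u v = P[s * t] := by
    rw [inner_Lp_eq_integral_mul]
    exact integral_congr_ae (hu.mul hv)
  simp only [Submodule.coe_inner]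
  rw [hinner ((MemLp.coeFn_toLp _).trans (hfa.mul hgb)) ((MemLp.coeFn_toLp _).trans
      (hfa'.mul hgb')), hV.isserlis ha hb ha' hb', hinner hfa hgb, hinner hfa' hgb',
    hinner hfa hfa', hinner hgb hgb', hinner hfa hgb', hinner hgb hfa']

theorem norm_toLp_mul_le (hV : IsCentredGaussianSpace V P) (f g : classesL2 V P) :
    ‖(hV.memLp_mul_classesL2 f g).toLp‖ ≤ √3 * ‖f‖ * ‖g‖ := by
  refine abs_le_of_sq_le_sq' ?_ (by positivity) |>.2
  have hfg : inner ℝ f g ^ 2 ≤ (‖f‖ * ‖g‖) ^ 2 := sq_le_sq.2 <| by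
    rw [abs_of_nonneg (by positivity : 0 ≤ ‖f‖ * ‖g‖)]
    exact abs_real_inner_le_norm f g
  rw [← real_inner_self_eq_norm_sq, hV.inner_toLp_mul, real_inner_self_eq_norm_sq,
    real_inner_self_eq_norm_sq, real_inner_comm f g, mul_pow, mul_pow, Real.sq_sqrt (by norm_num)]
  linarith

/-- Multiplication by a centred Gaussian variable, as an operator on a Gaussian space. -/
def mulL2 (hV : IsCentredGaussianSpace V P) (f : classesL2 V P) :
    classesL2 V P →L[ℝ] Lp ℝ 2 P :=
  LinearMap.mkContinuous
    { toFun := fun g => (hV.memLp_mul_classesL2 f g).toLp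
      map_add' := fun g h => by
        rw [← MemLp.toLp_add]
        refine MemLp.toLp_congr _ _ ?_
        filter_upwards [Lp.coeFn_add (g : Lp ℝ 2 P) h] with ω hω
        exact (congrArg _ hω).trans (mul_add _ _ _)
      map_smul' := fun r g => by
        rw [RingHom.id_apply, ← MemLp.toLp_const_smul]
        refine MemLp.toLp_congr _ _ ?_
        filter_upwards [Lp.coeFn_smul r (g : Lp ℝ 2 P)] with ω hω
        exact (congrArg _ hω).trans (mul_left_comm _ _ _) }
    (√3 * ‖f‖) (hV.norm_toLp_mul_le f)

theorem coeFn_mulL2 (hV : IsCentredGaussianSpace V P) (f g : classesL2 V P) :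
    hV.mulL2 f g =ᵐ[P] ⇑(f : Lp ℝ 2 P) * ⇑(g : Lp ℝ 2 P) :=
  (hV.memLp_mul_classesL2 f g).coeFn_toLp

theorem isIsserlisProduct_mulL2 (hV : IsCentredGaussianSpace V P) :
    IsIsserlisProduct hV.mulL2 :=
  hV.inner_toLp_mul

end IsCentredGaussianSpace

end GaussianProducts

section IsserlisKernel

variable {X G H : Type*} [MeasurableSpace X] [NormedAddCommGroup G] [InnerProductSpace ℝ G]
  [NormedAddCommGroup H] [InnerProductSpace ℝ H] {L : G → G →L[ℝ] H} {z : X → G}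
  {m : VectorMeasure X G} {γ : SignedMeasure (X × X)}

/-- The kernel `(x, S) ↦ L (z x) (m S)`, the abstract form of `(x, S) ↦ Z(x) M(S)`. -/
def productKernel (L : G → G →L[ℝ] H) (z : X → G) (m : VectorMeasure X G) (x : X) :
    VectorMeasure X H :=
  m.mapRange (L (z x)).toLinearMap.toAddMonoidHom (L (z x)).continuous

theorem productKernel_apply (x : X) (S : Set X) : productKernel L z m x S = L (z x) (m S) := rfl

variable [PseudoEMetricSpace X] [OpensMeasurableSpace X] [SecondCountableTopology X]
  {A B D K : Set X}

theorem IsIsserlisProduct.tendsto_sum_inner_productKernel (hL : IsIsserlisProduct L)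
    (hγ : ∀ A B, MeasurableSet A → MeasurableSet B → γ (A ×ˢ B) = inner ℝ (m A) (m B))
    (hK : IsCompact K) (hz : ContinuousOn z K) (hA : MeasurableSet A) (hAK : A ⊆ K)
    (hB : MeasurableSet B) (hBK : B ⊆ K)
    (hκA : RiemannIntegrable (fun x I => inner ℝ (z x) (m I)) A)
    (hκB : RiemannIntegrable (fun x I => inner ℝ (z x) (m I)) B) {q : ℝ}
    (hq : Tendsto (fun pq : TaggedPartition A × TaggedPartition B => pq.1.sum fun x I =>
      pq.2.sum fun y J => inner ℝ (z y) (m I) * inner ℝ (z x) (m J)) (fine A ×ˢ fine B) (𝓝 q)) :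
    Tendsto (fun pq : TaggedPartition A × TaggedPartition B => pq.1.sum fun x I =>
      pq.2.sum fun y J => inner ℝ (productKernel L z m x I) (productKernel L z m y J))
      (fine A ×ˢ fine B) (𝓝 (riemannIntegral (fun x I => inner ℝ (z x) (m I)) A
        * riemannIntegral (fun x I => inner ℝ (z x) (m I)) B
        + ∫ᵛ w in A ×ˢ B, inner ℝ (z w.1) (z w.2) ∂•γ + q)) := by
  have hc : ContinuousOn (fun w : X × X => inner ℝ (z w.1) (z w.2)) (K ×ˢ K) :=
    (hz.comp continuousOn_fst fun _ hw => hw.1).inner (hz.comp continuousOn_snd fun _ hw => hw.2)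
  have hκ := (hκA.tendsto.comp (tendsto_fst (g := fine B))).mul
    (hκB.tendsto.comp (tendsto_snd (f := fine A)))
  refine ((hκ.add (tendsto_sum_sum_mul_signedMeasure (γ := γ) hK hc hA hAK hB hBK)).add hq).congr
    fun pq => ?_
  simp only [Function.comp_apply, TaggedPartition.sum, Finset.sum_mul_sum,
    ← Finset.sum_add_distrib]
  refine Finset.sum_congr rfl fun j _ => Finset.sum_congr rfl fun k _ => ?_
  rw [productKernel_apply, productKernel_apply, hL,
    hγ _ _ (pq.1.measurableSet_cell j) (pq.2.measurableSet_cell k),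
    real_inner_comm (m (pq.1.cell j)) (z (pq.2.tag k)), mul_comm (inner ℝ _ (m (pq.2.cell k)))]

theorem IsIsserlisProduct.exists_signedMeasure_inner_riemannIntegral [CompleteSpace H]
    (hL : IsIsserlisProduct L)
    (hγ : ∀ A B, MeasurableSet A → MeasurableSet B → γ (A ×ˢ B) = inner ℝ (m A) (m B))
    (hK : IsCompact K) (hz : ContinuousOn z K) (hD : MeasurableSet D) (hDK : D ⊆ K)
    (hκ : RiemannIntegrable (fun x I => inner ℝ (z x) (m I)) D) :
    RiemannIntegrable (fun x => productKernel L z m x) D ∧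
    ∃ Q : SignedMeasure (X × X), ∀ A B, MeasurableSet A → A ⊆ D → MeasurableSet B → B ⊆ D →
      Tendsto (fun pq : TaggedPartition A × TaggedPartition B => pq.1.sum fun x I =>
        pq.2.sum fun y J => inner ℝ (z y) (m I) * inner ℝ (z x) (m J)) (fine A ×ˢ fine B)
        (𝓝 (Q (A ×ˢ B))) ∧
      inner ℝ (riemannIntegral (fun x => productKernel L z m x) A)
        (riemannIntegral (fun x => productKernel L z m x) B) =
        riemannIntegral (fun x I => inner ℝ (z x) (m I)) A
          * riemannIntegral (fun x I => inner ℝ (z x) (m I)) B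
          + ∫ᵛ w in A ×ˢ B, inner ℝ (z w.1) (z w.2) ∂•γ + Q (A ×ˢ B) := by
  have ht : TotallyBounded D := hK.totallyBounded.subset hDK
  have := neBot_fine hD ht
  obtain ⟨Q, hQ⟩ := exists_signedMeasure_tendsto_sum_inner_mul_inner hγ hK hz hD hDK
  have hinner := fun A B hA hAD hB hBD => hL.tendsto_sum_inner_productKernel hγ hK hz hA
    (hAD.trans hDK) hB (hBD.trans hDK) (hκ.mono hD ht hA hAD) (hκ.mono hD ht hB hBD)
    (hQ A B hA hAD hB hBD)
  have hF : RiemannIntegrable (fun x => productKernel L z m x) D :=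
    riemannIntegrable_of_tendsto_inner (hinner D D hD subset_rfl hD subset_rfl)
  refine ⟨hF, Q, fun A B hA hAD hB hBD => ⟨hQ A B hA hAD hB hBD, ?_⟩⟩
  have := neBot_fine hA (ht.subset hAD)
  have := neBot_fine hB (ht.subset hBD)
  exact tendsto_nhds_unique ((hF.mono hD ht hA hAD).tendsto_inner (hF.mono hD ht hB hBD))
    (hinner A B hA hAD hB hBD)

end IsserlisKernel

section RealMeasure

variable {X Y : Type*} [MeasurableSpace X] [Bornology X] [MeasurableSpace Y] [Bornology Y]

namespace RealMeasureOn

variable {D : Set X} {A B S : Set X}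

theorem window_apply (μ : RealMeasureOn D) (hA : MeasurableSet A) (hb : IsBounded A)
    (hAD : A ⊆ D) (hS : MeasurableSet S) : μ.window A S = μ (S ∩ A) := by
  rw [window, dif_pos ⟨hA, hb, hAD⟩]
  exact if_pos hS

theorem window_restrict (μ : RealMeasureOn D) (hA : MeasurableSet A) (hb : IsBounded A)
    (hAD : A ⊆ D) (hB : MeasurableSet B) (hBA : B ⊆ A) :
    (μ.window A).restrict B = μ.window B := by
  ext S hS
  rw [VectorMeasure.restrict_apply _ hB hS, μ.window_apply hA hb hAD (hS.inter hB),
    μ.window_apply hB (hb.subset hBA) (hBA.trans hAD) hS, inter_assoc, inter_eq_left.2 hBA]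

theorem setIntegral_window (μ : RealMeasureOn D) (hA : MeasurableSet A) (hb : IsBounded A)
    (hAD : A ⊆ D) (hB : MeasurableSet B) (hBA : B ⊆ A) (c : X → ℝ) :
    ∫ᵛ x in B, c x ∂•(μ.window A) = μ.integralOver B c := by
  rw [integralOver, μ.window_restrict hA hb hAD hB hBA]

theorem hasSum_integralOver [TopologicalSpace X] [OpensMeasurableSpace X] (μ : RealMeasureOn D)
    {K : Set X} {c : X → ℝ} (hK : IsCompact K) (hc : ContinuousOn c K) {A : ℕ → Set X}
    (hA : ∀ i, MeasurableSet (A i)) (hd : Pairwise (Disjoint on A)) (hb : IsBounded (⋃ i, A i))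
    (hAD : (⋃ i, A i) ⊆ D) (hAK : (⋃ i, A i) ⊆ K) :
    HasSum (fun i => μ.integralOver (A i) c) (μ.integralOver (⋃ i, A i) c) := by
  have hU : MeasurableSet (⋃ i, A i) := .iUnion hA
  have h := VectorMeasure.hasSum_setIntegral_iUnion (B := .lsmul ℝ ℝ) hA hd
    (integrableOn_signedMeasure_of_continuousOn (γ := μ.window (⋃ i, A i)) hK hc hU hAK)
  rw [μ.setIntegral_window hU hb hAD hU subset_rfl] at h
  simpa only [μ.setIntegral_window hU hb hAD (hA _) (subset_iUnion A _)] using h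

theorem prod_apply [TopologicalSpace X] [OpensMeasurableSpace X] [TopologicalSpace Y]
    [OpensMeasurableSpace Y] (μ : RealMeasureOn (univ : Set X)) (ν : RealMeasureOn (univ : Set Y))
    {I : Set X} {J : Set Y} (hI : MeasurableSet I) (hJ : MeasurableSet J)
    (hIb : IsBounded (closure I)) (hJb : IsBounded (closure J)) (hI0 : I.Nonempty)
    (hJ0 : J.Nonempty) : μ.prod ν (I ×ˢ J) = μ I * ν J := by
  rw [RealMeasureOn.prod, fst_image_prod _ hJ0, snd_image_prod hI0, VectorMeasure.prod_apply,
    μ.window_apply isClosed_closure.measurableSet hIb (subset_univ _) hI,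
    ν.window_apply isClosed_closure.measurableSet hJb (subset_univ _) hJ,
    inter_eq_left.2 subset_closure, inter_eq_left.2 subset_closure]
  rfl

end RealMeasureOn

theorem secondOrderKernel_prod {X Y : Type*} [MeasurableSpace Y] [PseudoMetricSpace Y]
    [OpensMeasurableSpace Y] (K : X → RealMeasureOn (univ : Set Y)) (x y : X) {I J : Set Y}
    (hI : MeasurableSet I) (hJ : MeasurableSet J) (hIb : IsBounded I) (hJb : IsBounded J)
    (hI0 : I.Nonempty) (hJ0 : J.Nonempty) :
    secondOrderKernel K (x, y) (I ×ˢ J) = K y I * K x J :=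
  (K y).prod_apply (K x) hI hJ (Metric.isBounded_closure_iff.2 hIb)
    (Metric.isBounded_closure_iff.2 hJb) hI0 hJ0

end RealMeasure

section MeanSquare

variable {Ω X Y : Type*} [MeasurableSpace Ω] {P : Measure Ω}

namespace MSProcess

variable [TopologicalSpace X] (Z : MSProcess P X)

/-- The value at `x` of a second-order process, as an element of `L²`. -/
def toL2 (x : X) : Lp ℝ 2 P :=
  (Z.memLp x).toLp (Z x)

theorem coeFn_toL2 (x : X) : Z.toL2 x =ᵐ[P] Z x :=
  (Z.memLp x).coeFn_toLp

theorem continuous_toL2 : Continuous Z.toL2 := by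
  refine continuous_iff_continuousAt.2 fun x₀ => tendsto_iff_edist_tendsto_0.2 ?_
  simp only [toL2, Lp.edist_toLp_toLp]
  exact Z.tendsto_L2 x₀

end MSProcess

theorem covariance_L2 [IsProbabilityMeasure P] (f g : Lp ℝ 2 P) :
    cov[f, g; P] = inner ℝ f g - (∫ ω, f ω ∂P) * ∫ ω, g ω ∂P := by
  rw [covariance_eq_sub (Lp.memLp f) (Lp.memLp g), inner_Lp_eq_integral_mul]
  rfl

theorem covariance_eq_inner_toL2 [IsProbabilityMeasure P] [TopologicalSpace X] {Z : MSProcess P X}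
    (hZ : ∀ x, ∫ ω, Z x ω ∂P = 0) (x y : X) :
    cov[Z x, Z y; P] = inner ℝ (Z.toL2 x) (Z.toL2 y) := by
  rw [covariance_eq_sub (Z.memLp x) (Z.memLp y), hZ, zero_mul, sub_zero, inner_Lp_eq_integral_mul]
  exact integral_congr_ae ((Z.coeFn_toL2 x).mul (Z.coeFn_toL2 y)).symm

theorem continuous_covariance [IsProbabilityMeasure P] [TopologicalSpace X] {Z : MSProcess P X}
    (hZ : ∀ x, ∫ ω, Z x ω ∂P = 0) : Continuous fun p : X × X => cov[Z p.1, Z p.2; P] := by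
  simp only [covariance_eq_inner_toL2 hZ]
  exact (Z.continuous_toL2.comp continuous_fst).inner (Z.continuous_toL2.comp continuous_snd)

theorem crossCov_eq_inner [IsProbabilityMeasure P] [TopologicalSpace X] [MeasurableSpace Y]
    [Bornology Y] {Z : MSProcess P X} (hZ : ∀ x, ∫ ω, Z x ω ∂P = 0)
    (M : RandomMeasure P (univ : Set Y)) (x : X) (A : Set Y) :
    crossCov Z M x A = inner ℝ (Z.toL2 x) (M A) := by
  refine (covariance_L2_eq_inner (Z.memLp x) (M A)).trans ?_
  rw [hZ, zero_mul, sub_zero]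
  rfl

namespace RandomMeasure

variable [MeasurableSpace Y] [Bornology Y] {E D A B : Set Y} (M : RandomMeasure P E)

theorem apply_empty : M ∅ = 0 := by
  have h := M.hasSum_iUnion' (fun _ => ∅) (fun _ => MeasurableSet.empty)
    (fun i j _ => disjoint_bot_left) (by simp) (by simp)
  simpa using tendsto_nhds_unique tendsto_const_nhds h.summable.tendsto_atTop_zero

open Classical in
/-- The vector measure `S ↦ M (S ∩ D)`, for a bounded measurable `D`, with values in a space `G`
that contains the values of `M`. -/
def window (G : Submodule ℝ (Lp ℝ 2 P)) (hG : ∀ A, MeasurableSet A → IsBounded A → M A ∈ G)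
    (hD : MeasurableSet D) (hDb : IsBounded D) (hDE : D ⊆ E) : VectorMeasure Y G where
  measureOf' S := if h : MeasurableSet S then
    ⟨M (S ∩ D), hG _ (h.inter hD) (hDb.subset inter_subset_right)⟩ else 0
  empty' := by simp [M.apply_empty]
  not_measurable' S hS := dif_neg hS
  m_iUnion' S hS hd := by
    have h := M.hasSum_iUnion' (fun i => S i ∩ D) (fun i => (hS i).inter hD)
      (fun i j hij => (hd hij).mono inter_subset_left inter_subset_left)
      (hDb.subset (iUnion_subset fun i => inter_subset_right))
      ((iUnion_subset fun i => inter_subset_right).trans hDE)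
    refine (Topology.IsInducing.subtypeVal.hasSum_iff (g := G.subtype) _ _).1 ?_
    simpa [Function.comp_def, hS, MeasurableSet.iUnion hS, iUnion_inter] using h

theorem coe_window_apply {G : Submodule ℝ (Lp ℝ 2 P)}
    (hG : ∀ A, MeasurableSet A → IsBounded A → M A ∈ G) (hD : MeasurableSet D)
    (hDb : IsBounded D) (hDE : D ⊆ E) (hA : MeasurableSet A) :
    (M.window G hG hD hDb hDE A : Lp ℝ 2 P) = M (A ∩ D) :=
  congrArg _ (dif_pos hA)

theorem cov_window_prod [IsProbabilityMeasure P]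
    (hM : ∀ A, MeasurableSet A → IsBounded A → ∫ ω, M A ω ∂P = 0) (hD : MeasurableSet D)
    (hDb : IsBounded D) (hDE : D ⊆ E) (hA : MeasurableSet A) (hB : MeasurableSet B) :
    M.cov.window (D ×ˢ D) (A ×ˢ B) = inner ℝ (M (A ∩ D)) (M (B ∩ D)) := by
  have hS {S : Set Y} : IsBounded (S ∩ D) := hDb.subset inter_subset_right
  rw [M.cov.window_apply (hD.prod hD) (hDb.prod hDb) (prod_mono hDE hDE) (hA.prod hB),
    prod_inter_prod, M.cov_prod _ _ (hA.inter hD) hS (inter_subset_right.trans hDE)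
      (hB.inter hD) hS (inter_subset_right.trans hDE), covariance_L2, hM _ (hA.inter hD) hS,
    zero_mul, sub_zero]

end RandomMeasure

end MeanSquare

section StochasticIntegral

variable {Ω X : Type*} [MeasurableSpace Ω] {P : Measure Ω} [MeasurableSpace X]

section JointSpan

variable [TopologicalSpace X] [Bornology X]

/-- The linear span of all the variables `Z(x)` and `M(A)`. -/
def jointSpan (Z : MSProcess P X) (M : RandomMeasure P (univ : Set X)) : Submodule ℝ (Ω → ℝ) :=
  .span ℝ <| range <| Sum.elim (fun x : X => Z x)
    fun A : {A : Set X // MeasurableSet A ∧ IsBounded A} => ⇑(M A.1)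

variable {Z : MSProcess P X} {M : RandomMeasure P (univ : Set X)}

theorem JointlyGaussian.isCentredGaussianSpace_jointSpan (hG : JointlyGaussian Z M)
    (hZ : ∀ x, ∫ ω, Z x ω ∂P = 0)
    (hM : ∀ A, MeasurableSet A → IsBounded A → ∫ ω, M A ω ∂P = 0) :
    IsCentredGaussianSpace (jointSpan Z M) P :=
  isCentredGaussianSpace_span hG (by rintro (x | ⟨A, hA, hb⟩); exacts [hZ x, hM A hA hb])

theorem toL2_mem_classesL2_jointSpan (x : X) : Z.toL2 x ∈ classesL2 (jointSpan Z M) P :=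
  ⟨Z x, Submodule.subset_span ⟨.inl x, rfl⟩, Z.coeFn_toL2 x⟩

theorem apply_mem_classesL2_jointSpan (A : Set X) (hA : MeasurableSet A) (hb : IsBounded A) :
    M A ∈ classesL2 (jointSpan Z M) P :=
  ⟨M A, Submodule.subset_span ⟨.inr ⟨A, hA, hb⟩, rfl⟩, ae_eq_rfl⟩

/-- `F(x, I)` is the product `Z(x) M(I)`, as an element of `L²`, for all cells `I` inside `D`. -/
def IsProductKernel (Z : MSProcess P X) (M : RandomMeasure P (univ : Set X))
    (F : X → Set X → Lp ℝ 2 P) (D : Set X) : Prop :=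
  ∀ x I, MeasurableSet I → I ⊆ D → F x I =ᵐ[P] Z x * M I

theorem IsProductKernel.mono {F : X → Set X → Lp ℝ 2 P} {A D : Set X}
    (h : IsProductKernel Z M F D) (hAD : A ⊆ D) : IsProductKernel Z M F A :=
  fun x I hI hIA => h x I hI (hIA.trans hAD)

theorem IsProductKernel.integral_eq_crossCov [IsProbabilityMeasure P] {F : X → Set X → Lp ℝ 2 P}
    {D I : Set X} (h : IsProductKernel Z M F D) (hZ : ∀ x, ∫ ω, Z x ω ∂P = 0) (x : X)
    (hI : MeasurableSet I) (hID : I ⊆ D) : ∫ ω, F x I ω ∂P = crossCov Z M x I := by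
  rw [crossCov_eq_inner hZ, inner_Lp_eq_integral_mul]
  exact integral_congr_ae ((h x I hI hID).trans ((Z.coeFn_toL2 x).symm.mul ae_eq_rfl))

end JointSpan

variable [PseudoMetricSpace X] {Z : MSProcess P X} {M : RandomMeasure P (univ : Set X)}
  {F : X → Set X → Lp ℝ 2 P} {A D : Set X}

theorem IsProductKernel.isStochasticIntegral_iff_tendsto (h : IsProductKernel Z M F A)
    {I : Lp ℝ 2 P} :
    IsStochasticIntegral Z M A I ↔
      Tendsto (fun p : TaggedPartition A => p.sum F) (fine A) (𝓝 I) := by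
  rw [← forall_riemannSystem_tendsto_iff (f := fun p => p.sum F)]
  refine forall_congr' fun R => ?_
  rw [tendsto_iff_edist_tendsto_0]
  refine tendsto_congr fun n => ?_
  rw [Lp.edist_def]
  refine eLpNorm_congr_ae (EventuallyEq.sub ?_ ae_eq_rfl)
  have hsum : ∀ᵐ ω ∂P, ∀ j, F (R.tag n j) (R.cell n j) ω = (Z (R.tag n j) * M (R.cell n j)) ω :=
    ae_all_iff.2 fun j => h _ _ (R.measurableSet_cell n j) ((R.partition n).cell_subset j)
  have hsumF : ⇑((R.partition n).sum F) =ᵐ[P] ∑ j, ⇑(F (R.tag n j) (R.cell n j)) :=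
    Lp.coeFn_finsetSum _ _
  filter_upwards [hsum, hsumF] with ω hω hF
  rw [hF, Finset.sum_apply]
  exact Finset.sum_congr rfl fun j _ => (hω j).symm

theorem IsProductKernel.integral_riemannIntegral [IsProbabilityMeasure P] [(fine A).NeBot]
    (h : IsProductKernel Z M F A) (hZ : ∀ x, ∫ ω, Z x ω ∂P = 0) (hF : RiemannIntegrable F A) :
    ∫ ω, (riemannIntegral F A : Lp ℝ 2 P) ω ∂P = riemannIntegral (fun x => crossCov Z M x) A := by
  rw [integral_L2_eq_inner, ← innerSL_apply_apply ℝ, ← hF.riemannIntegral_map]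
  refine riemannIntegral_congr fun x I hI hIA _ => ?_
  rw [innerSL_apply_apply, ← integral_L2_eq_inner, h.integral_eq_crossCov hZ x hI hIA]

variable [OpensMeasurableSpace X]

theorem isQuasiSelfIntegral_secondOrderKernel_iff_tendsto {K : X → RealMeasureOn (univ : Set X)}
    {B : Set X} (hA : IsBounded A) (hB : IsBounded B) {q : ℝ} :
    IsQuasiSelfIntegral (secondOrderKernel K) A B q ↔
      Tendsto (fun pq : TaggedPartition A × TaggedPartition B => pq.1.sum fun x I =>
        pq.2.sum fun y J => K y I * K x J) (fine A ×ˢ fine B) (𝓝 q) := by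
  rw [isQuasiSelfIntegral_iff_tendsto]
  refine tendsto_congr fun pq => ?_
  rw [TaggedPartition.sum_prod]
  exact pq.1.sum_congr fun x I hI hIA hx => pq.2.sum_congr fun y J hJ hJB hy =>
    secondOrderKernel_prod K x y hI hJ (hA.subset hIA) (hB.subset hJB) ⟨x, hx⟩ ⟨y, hy⟩

variable [SecondCountableTopology X] [IsProbabilityMeasure P]

theorem JointlyGaussian.exists_inner_riemannIntegral (hG : JointlyGaussian Z M)
    (hZ : ∀ x, ∫ ω, Z x ω ∂P = 0)
    (hM : ∀ A, MeasurableSet A → IsBounded A → ∫ ω, M A ω ∂P = 0) (hD : MeasurableSet D)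
    (hDc : IsCompact (closure D)) (hK : RiemannIntegrable (fun x => crossCov Z M x) D) :
    ∃ F : X → VectorMeasure X (Lp ℝ 2 P), IsProductKernel Z M (fun x => F x) D ∧
      RiemannIntegrable (fun x => F x) D ∧
      ∃ Q : SignedMeasure (X × X), ∀ A B, MeasurableSet A → A ⊆ D → MeasurableSet B → B ⊆ D →
        Tendsto (fun pq : TaggedPartition A × TaggedPartition B => pq.1.sum fun x I =>
          pq.2.sum fun y J => crossCov Z M y I * crossCov Z M x J) (fine A ×ˢ fine B)
          (𝓝 (Q (A ×ˢ B))) ∧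
        inner ℝ (riemannIntegral (fun x => F x) A) (riemannIntegral (fun x => F x) B) =
          riemannIntegral (fun x => crossCov Z M x) A * riemannIntegral (fun x => crossCov Z M x) B
            + ∫ᵛ w in A ×ˢ B, inner ℝ (Z.toL2 w.1) (Z.toL2 w.2) ∂•(M.cov.window (D ×ˢ D))
            + Q (A ×ˢ B) := by
  have hDb : IsBounded D := hDc.isBounded.subset subset_closure
  have hV := hG.isCentredGaussianSpace_jointSpan hZ hM
  let z : X → classesL2 (jointSpan Z M) P := fun x => ⟨Z.toL2 x, toL2_mem_classesL2_jointSpan x⟩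
  let m : VectorMeasure X (classesL2 (jointSpan Z M) P) :=
    M.window _ apply_mem_classesL2_jointSpan hD hDb (subset_univ D)
  have hz : Continuous z := Z.continuous_toL2.subtype_mk _
  have hm {S : Set X} (hS : MeasurableSet S) : (m S : Lp ℝ 2 P) = M (S ∩ D) :=
    M.coe_window_apply _ hD hDb _ hS
  have hmD {S : Set X} (hS : MeasurableSet S) (hSD : S ⊆ D) : (m S : Lp ℝ 2 P) = M S := by
    rw [hm hS, inter_eq_left.2 hSD]
  have hzm (x : X) (I : Set X) (hI : MeasurableSet I) (hID : I ⊆ D) :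
      inner ℝ (z x) (m I) = crossCov Z M x I := by
    rw [crossCov_eq_inner hZ, ← hmD hI hID, Submodule.coe_inner]
  have hγ (A B) (hA : MeasurableSet A) (hB : MeasurableSet B) :
      M.cov.window (D ×ˢ D) (A ×ˢ B) = inner ℝ (m A) (m B) := by
    rw [M.cov_window_prod hM hD hDb (subset_univ D) hA hB, Submodule.coe_inner, hm hA, hm hB]
  obtain ⟨hF, Q, hQ⟩ :=
    hV.isIsserlisProduct_mulL2.exists_signedMeasure_inner_riemannIntegral hγ hDc hz.continuousOn hD
      subset_closure ((riemannIntegrable_congr fun x I hI hID _ => hzm x I hI hID).2 hK)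
  refine ⟨_, fun x I hI hID => ?_, hF, Q, fun A B hA hAD hB hBD => ⟨?_, ?_⟩⟩
  · exact (hV.coeFn_mulL2 (z x) (m I)).trans ((Z.coeFn_toL2 x).mul (by rw [hmD hI hID]))
  · refine (hQ A B hA hAD hB hBD).1.congr fun pq =>
      pq.1.sum_congr fun x I hI hIA _ => pq.2.sum_congr fun y J hJ hJB _ => ?_
    rw [hzm y I hI (hIA.trans hAD), hzm x J hJ (hJB.trans hBD)]
  · rw [(hQ A B hA hAD hB hBD).2, riemannIntegral_congr fun x I hI hIA _ => hzm x I hI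
      (hIA.trans hAD), riemannIntegral_congr fun x I hI hIB _ => hzm x I hI (hIB.trans hBD)]
    rfl

theorem JointlyGaussian.exists_covariance_riemannIntegral (hG : JointlyGaussian Z M)
    (hZ : ∀ x, ∫ ω, Z x ω ∂P = 0)
    (hM : ∀ A, MeasurableSet A → IsBounded A → ∫ ω, M A ω ∂P = 0) (hD : MeasurableSet D)
    (hDc : IsCompact (closure D)) (hK : RiemannIntegrable (fun x => crossCov Z M x) D) :
    ∃ F : X → VectorMeasure X (Lp ℝ 2 P), IsProductKernel Z M (fun x => F x) D ∧
      RiemannIntegrable (fun x => F x) D ∧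
      ∃ Q : SignedMeasure (X × X), ∀ A B, MeasurableSet A → A ⊆ D → MeasurableSet B → B ⊆ D →
        IsQuasiSelfIntegral (secondOrderKernel (crossCov Z M)) A B (Q (A ×ˢ B)) ∧
        cov[⇑(riemannIntegral (fun x => F x) A), ⇑(riemannIntegral (fun x => F x) B); P] =
          M.cov.integralOver (A ×ˢ B) (fun p => cov[Z p.1, Z p.2; P]) + Q (A ×ˢ B) := by
  have hDb : IsBounded D := hDc.isBounded.subset subset_closure
  have ht : TotallyBounded D := hDc.totallyBounded.subset subset_closure
  obtain ⟨F, hFZM, hF, Q, hQ⟩ := hG.exists_inner_riemannIntegral hZ hM hD hDc hK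
  refine ⟨F, hFZM, hF, Q, fun A B hA hAD hB hBD => ⟨?_, ?_⟩⟩
  · rw [isQuasiSelfIntegral_secondOrderKernel_iff_tendsto (hDb.subset hAD) (hDb.subset hBD)]
    exact (hQ A B hA hAD hB hBD).1
  have := neBot_fine hA (ht.subset hAD)
  have := neBot_fine hB (ht.subset hBD)
  rw [covariance_L2, (hQ A B hA hAD hB hBD).2,
    (hFZM.mono hAD).integral_riemannIntegral hZ (hF.mono hD ht hA hAD),
    (hFZM.mono hBD).integral_riemannIntegral hZ (hF.mono hD ht hB hBD), add_assoc,
    add_sub_cancel_left, M.cov.setIntegral_window (hD.prod hD) (hDb.prod hDb)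
      (prod_mono (subset_univ D) (subset_univ D)) (hA.prod hB) (prod_mono hAD hBD)]
  simp only [covariance_eq_inner_toL2 hZ]

/-- The Riemann integrals `A ↦ ∫_A F(x, dx)` of an `L²`-valued kernel, as a random measure whose
covariance measure is the sum of an indefinite integral with respect to `μ` and of `Q`. -/
def RandomMeasure.ofRiemannIntegral {F : X → VectorMeasure X (Lp ℝ 2 P)}
    (hF : RiemannIntegrable (fun x => F x) D) (hD : MeasurableSet D) (hDc : IsCompact (closure D))
    (μ : RealMeasureOn (univ ×ˢ univ : Set (X × X))) {c : X × X → ℝ} (hc : Continuous c)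
    (Q : SignedMeasure (X × X))
    (hcov : ∀ A B, MeasurableSet A → A ⊆ D → MeasurableSet B → B ⊆ D →
      μ.integralOver (A ×ˢ B) c + Q (A ×ˢ B) =
        cov[⇑(riemannIntegral (fun x => F x) A), ⇑(riemannIntegral (fun x => F x) B); P]) :
    RandomMeasure P D where
  toFun := riemannIntegral fun x => F x
  hasSum_iUnion' _ hA hd _ hAD :=
    hF.hasSum_riemannIntegral hD (hDc.totallyBounded.subset subset_closure) hA hd hAD
  cov.toFun S := μ.integralOver S c + Q S
  cov.hasSum_iUnion' _ hS hd hb hSD :=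
    (μ.hasSum_integralOver (hDc.prod hDc) hc.continuousOn hS hd hb
      (hSD.trans (prod_mono (subset_univ D) (subset_univ D)))
      (hSD.trans (prod_mono subset_closure subset_closure))).add
      (Q.hasSum_of_disjoint_iUnion hS hd)
  cov_prod A B hA _ hAD hB _ hBD := hcov A B hA hAD hB hBD

end StochasticIntegral

end SelfIntegral

end

theorem mainTheorem9_general {Ω : Type*} [MeasurableSpace Ω] (P : Measure Ω)
    [IsProbabilityMeasure P] {X : Type*} [MeasurableSpace X] [PseudoMetricSpace X]
    [OpensMeasurableSpace X] [SecondCountableTopology X] (Z : SelfIntegral.MSProcess P X)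
    (M : SelfIntegral.RandomMeasure P (univ : Set X)) (hZ : ∀ x, ∫ ω, Z x ω ∂P = 0)
    (hM : ∀ A, MeasurableSet A → IsBounded A → ∫ ω, M A ω ∂P = 0)
    (hG : SelfIntegral.JointlyGaussian Z M) (D : Set X) (hD : MeasurableSet D)
    (hDc : IsCompact (closure D))
    (hK : SelfIntegral.SelfIntegrable (fun x => SelfIntegral.crossCov Z M x) D) :
    ∃ N : SelfIntegral.RandomMeasure P D,
      (∀ A, MeasurableSet A → A ⊆ D →
        SelfIntegral.IsStochasticIntegral Z M A (N A) ∧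
        ∀ I, SelfIntegral.IsStochasticIntegral Z M A I → I = N A) ∧
      (∀ A, MeasurableSet A → A ⊆ D →
        SelfIntegral.SelfIntegrable (fun x => SelfIntegral.crossCov Z M x) A ∧
        SelfIntegral.IsSelfIntegral (fun x => SelfIntegral.crossCov Z M x) A (N.mean A)) ∧
      (∀ A B, MeasurableSet A → A ⊆ D → MeasurableSet B → B ⊆ D →
        ∃ q : ℝ,
          SelfIntegral.IsQuasiSelfIntegral
            (SelfIntegral.secondOrderKernel (SelfIntegral.crossCov Z M)) A B q ∧
          (∀ q', SelfIntegral.IsQuasiSelfIntegral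
            (SelfIntegral.secondOrderKernel (SelfIntegral.crossCov Z M)) A B q' → q' = q) ∧
          N.cov (A ×ˢ B) =
            M.cov.integralOver (A ×ˢ B) (fun p => cov[Z p.1, Z p.2; P]) + q) := by
  have ht : TotallyBounded D := hDc.totallyBounded.subset subset_closure
  have := SelfIntegral.neBot_fine hD ht
  have hKD := SelfIntegral.selfIntegrable_iff_riemannIntegrable.1 hK
  obtain ⟨F, hFZM, hF, Q, hQ⟩ := hG.exists_covariance_riemannIntegral hZ hM hD hDc hKD
  refine ⟨.ofRiemannIntegral hF hD hDc M.cov (SelfIntegral.continuous_covariance hZ) Q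
    fun A B hA hAD hB hBD => (hQ A B hA hAD hB hBD).2.symm, fun A hA hAD => ?_,
    fun A hA hAD => ?_, fun A B hA hAD hB hBD => ?_⟩ <;>
    have := SelfIntegral.neBot_fine hA (ht.subset hAD)
  · simp only [(hFZM.mono hAD).isStochasticIntegral_iff_tendsto]
    have hFA := (hF.mono hD ht hA hAD).tendsto
    exact ⟨hFA, fun I hI => tendsto_nhds_unique hI hFA⟩
  · have hKA := hKD.mono hD ht hA hAD
    refine ⟨SelfIntegral.selfIntegrable_iff_riemannIntegrable.2 hKA,
      SelfIntegral.isSelfIntegral_iff_tendsto.2 ?_⟩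
    convert hKA.tendsto
    exact (hFZM.mono hAD).integral_riemannIntegral hZ (hF.mono hD ht hA hAD)
  · have := SelfIntegral.neBot_fine hB (ht.subset hBD)
    have hq := (hQ A B hA hAD hB hBD).1
    exact ⟨_, hq, fun q' hq' => tendsto_nhds_unique
      (SelfIntegral.isQuasiSelfIntegral_iff_tendsto.1 hq')
      (SelfIntegral.isQuasiSelfIntegral_iff_tendsto.1 hq), rfl⟩

theorem mainTheorem9 {Ω : Type*} [MeasurableSpace Ω] (P : Measure Ω) [IsProbabilityMeasure P]
    (d : ℕ)
    (Z : SelfIntegral.MSProcess P (EuclideanSpace ℝ (Fin d)))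
    (M : SelfIntegral.RandomMeasure P (univ : Set (EuclideanSpace ℝ (Fin d))))
    (hZ : ∀ x, ∫ ω, Z x ω ∂P = 0)
    (hM : ∀ A, MeasurableSet A → IsBounded A → ∫ ω, M A ω ∂P = 0)
    (hG : SelfIntegral.JointlyGaussian Z M)
    (D : Set (EuclideanSpace ℝ (Fin d))) (hD : IsCompact D)
    (hK : SelfIntegral.SelfIntegrable (fun x => SelfIntegral.crossCov Z M x) D)
    (hKtv : SelfIntegral.SelfIntegrable
      (SelfIntegral.tvKernel fun x => SelfIntegral.crossCov Z M x) D)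
    (hK₂ : SelfIntegral.QuasiSelfIntegrable
      (SelfIntegral.secondOrderKernel (SelfIntegral.crossCov Z M)) D D)
    (hK₂tv : SelfIntegral.QuasiSelfIntegrable
      (SelfIntegral.tvKernel (SelfIntegral.secondOrderKernel (SelfIntegral.crossCov Z M))) D D) :
    ∃ N : SelfIntegral.RandomMeasure P D,
      -- `N A` is the uniquely defined stochastic integral `∫_A Z dM`
      (∀ A, MeasurableSet A → A ⊆ D →
        SelfIntegral.IsStochasticIntegral Z M A (N A) ∧
        ∀ I, SelfIntegral.IsStochasticIntegral Z M A I → I = N A) ∧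
      -- the mean measure is given by the self-integrals of the cross-covariance kernel
      (∀ A, MeasurableSet A → A ⊆ D →
        SelfIntegral.SelfIntegrable (fun x => SelfIntegral.crossCov Z M x) A ∧
        SelfIntegral.IsSelfIntegral (fun x => SelfIntegral.crossCov Z M x) A (N.mean A)) ∧
      -- the covariance measure is given by the quasi-self-integrals of the second-order kernel
      (∀ A B, MeasurableSet A → A ⊆ D → MeasurableSet B → B ⊆ D →
        ∃ q : ℝ,
          SelfIntegral.IsQuasiSelfIntegral
            (SelfIntegral.secondOrderKernel (SelfIntegral.crossCov Z M)) A B q ∧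
          (∀ q', SelfIntegral.IsQuasiSelfIntegral
            (SelfIntegral.secondOrderKernel (SelfIntegral.crossCov Z M)) A B q' → q' = q) ∧
          N.cov (A ×ˢ B) =
            M.cov.integralOver (A ×ˢ B) (fun p => cov[Z p.1, Z p.2; P]) + q) := by
  exact mainTheorem9_general P Z M hZ hM hG D hD.measurableSet hD.closure hK
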